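/- Let $K\ge 2$, let $\Delta_{K-1}=\{\theta\in\mathbb{R}^K:\theta_i\ge 0,\ \sum_{i=1}^K\theta_i=1\}$, and for $\alpha\in(0,\infty)^K$ let $\mathrm{Dir}_\alpha$ denote the Dirichlet distribution on $\Delta_{K-1}$ and also its density $$\mathrm{Dir}_\alpha(\theta)=\frac{1}{B(\alpha)}\prod_{i=1}^K\theta_i^{\alpha_i-1},\qquad B(\alpha)=\frac{\prod_{i=1}^K\Gamma(\alpha_i)}{\Gamma\left(\sum_{i=1}^K\alpha_i\right)},$$ with respect to Lebesgue measure in the first $K-1$ coordinates. Let $H:\mathbb{R}^K\to\mathbb{R}\cup\{-\infty\}$ and $\theta^*\in\Delta_{K-1}$, where $\theta_1^*=\dots=\theta_m^*=0$ and $\theta_{m+1}^*,\dots,\theta_K^*>0$ (so $m$ is the number of zero components of $\theta^*$, and the coordinates are labelled accordingly). Assume: (A1) $\theta^*$ is the unique maximizer of $H$ over $\Delta_{K-1}$. (A2) $H$ is continuous on $\Delta_{K-1}$ (as a function into $[-\infty,\infty]$), and it is finite and twice continuously differentiable in an open neighborhood of $\theta^*$ in $\mathbb{R}^K$. (A3)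 $\nabla H(\theta^*)=-\sum_{i=1}^m\lambda_i e_i+\mu\mathbf{1}$ for some $\mu\in\mathbb{R}$ and some $\lambda_1,\dots,\lambda_m>0$ (strict complementarity). (A4) $d^\top\nabla^2H(\theta^*)d<0$ for every $d\in\mathbb{R}^K\setminus\{0\}$ with $\sum_{i=1}^K d_i=0$ and $d_i=0$ for all $i\le m$. Fix $\alpha\in(0,\infty)^K$, $\gamma\in(0,1)$, a sample size $N\ge1$ and $\epsilon$ with $0<\epsilon<\min_{i:\theta_i^*>0}\theta_i^*$, and let $\Delta_{K-1}^\epsilon=\{\theta\in\Delta_{K-1}:\theta_i\ge\epsilon\text{ for all }i\text{ with }\theta_i^*>0\}$. For real $n>0$ consider the standard Monte Carlo estimator $$\hat p_{\mathrm{MC}}=\frac1N\sum_{i=1}^N e^{nH(\theta^{(i)})},\qquad \theta^{(i)}\overset{\text{iid}}{\sim}\mathrm{Dir}_\alpha,$$ and the truncated importance sampling estimator $$\hat p_{\mathrm{IS}}^{\gamma}=\frac1N\sum_{i=1}^N e^{nH(\theta^{(i)})}\,\frac{\mathrm{Dir}_\alpha(\theta^{(i)})}{\mathrm{Dir}_{\alpha+n^\gamma\theta^*}(\theta^{(i)})}\,\mathbf{1}_{\Delta_{K-1}^\epsilon}(\theta^{(i)}),\qquad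 \theta^{(i)}\overset{\text{iid}}{\sim}\mathrm{Dir}_{\alpha+n^\gamma\theta^*},$$ where $e^{-\infty}=0$. Then, as $n\to\infty$, $$\frac{\mathrm{Var}(\hat p_{\mathrm{IS}}^{\gamma})}{\mathrm{Var}(\hat p_{\mathrm{MC}})}=\Theta\left(n^{-\gamma\frac{K-1-m}{2}}\,n^{-\gamma\sum_{i=1}^m\alpha_i}\right).$$ -/

import Mathlib

open MeasureTheory ProbabilityTheory Filter Asymptotics

namespace DirichletIS

/-- The probability simplex of vectors with `K = k + 1` nonnegative coordinates summing to one. -/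
def simplex (k : ℕ) : Set (Fin (k + 1) → ℝ) :=
  {θ | (∀ i, 0 ≤ θ i) ∧ ∑ i, θ i = 1}

/-- The projected simplex in the first `k = K - 1` coordinates. -/
def projSimplex (k : ℕ) : Set (Fin k → ℝ) :=
  {y | (∀ i, 0 ≤ y i) ∧ ∑ i, y i ≤ 1}

/-- The coordinate map `T(y) = (y₁, …, y_{K-1}, 1 - ∑ yᵢ)`. -/
def coordMap {k : ℕ} (y : Fin k → ℝ) : Fin (k + 1) → ℝ :=
  Fin.snoc (α := fun _ => ℝ) y (1 - ∑ i, y i)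

/-- The multivariate Beta function `B(α) = ∏ Γ(αᵢ) / Γ(∑ αᵢ)`. -/
noncomputable def multiBeta {k : ℕ} (α : Fin (k + 1) → ℝ) : ℝ :=
  (∏ i, Real.Gamma (α i)) / Real.Gamma (∑ i, α i)

/-- The Dirichlet density `Dir_α(θ) = B(α)⁻¹ ∏ θᵢ ^ (αᵢ - 1)`, for `θ` in the simplex. -/
noncomputable def dirichletDensity {k : ℕ} (α θ : Fin (k + 1) → ℝ) : ℝ :=
  1 / multiBeta α * ∏ i, θ i ^ (α i - 1)

/-- The Dirichlet distribution on the simplex: in the first `K - 1` coordinates it has the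
Lebesgue density `y ↦ Dir_α(T(y))` on the projected simplex. -/
noncomputable def dirichlet {k : ℕ} (α : Fin (k + 1) → ℝ) : Measure (Fin (k + 1) → ℝ) :=
  (((volume : Measure (Fin k → ℝ)).restrict (projSimplex k)).withDensity
    (fun y => ENNReal.ofReal (dirichletDensity α (coordMap y)))).map coordMap

/-- The real number `e^{n h}` for an extended real `h < +∞`, with `e^{-∞} = 0` (for `n > 0`). -/
noncomputable def expScaled (n : ℝ) (h : EReal) : ℝ :=
  (EReal.exp ((n : EReal) * h)).toReal

/-- The real-valued version of `H`, used only near points where `H` is finite. -/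
noncomputable def realVersion {k : ℕ} (H : (Fin (k + 1) → ℝ) → EReal) :
    (Fin (k + 1) → ℝ) → ℝ :=
  fun θ => (H θ).toReal

/-- The standing assumptions on an objective `H : ℝ^K → ℝ ∪ {-∞}` and its maximizer `θs` over the
simplex, whose zero coordinates are the first `m` ones. -/
structure Assumptions {k : ℕ} (H : (Fin (k + 1) → ℝ) → EReal)
    (θs : Fin (k + 1) → ℝ) (m : ℕ) : Prop where
  /-- `H` takes values in `ℝ ∪ {-∞}`. -/
  ne_top : ∀ θ, H θ ≠ ⊤
  mem_simplex : θs ∈ simplex k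
  /-- The zero components of `θs` are exactly the first `m` components. -/
  zero_iff : ∀ i, θs i = 0 ↔ (i : ℕ) < m
  /-- Unique maximum. -/
  unique_max : ∀ θ ∈ simplex k, θ ≠ θs → H θ < H θs
  /-- Continuity on the simplex. -/
  continuousOn : ContinuousOn H (simplex k)
  /-- `H` is finite and twice continuously differentiable in a neighborhood of `θs` in `ℝ^K`. -/
  finite_near : ∀ᶠ θ in nhds θs, H θ ≠ ⊥
  contDiffAt : ContDiffAt ℝ 2 (realVersion H) θs
  /-- Strict complementarity: `∇H(θs) = -∑_{i ≤ m} lamᵢ eᵢ + μ 𝟏` with all `lamᵢ > 0`. -/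
  strict_compl : ∃ (lam : Fin (k + 1) → ℝ) (μ : ℝ), (∀ i : Fin (k + 1), (i : ℕ) < m → 0 < lam i) ∧
    ∀ i, fderiv ℝ (realVersion H) θs (Pi.single i 1) = (if (i : ℕ) < m then -lam i else 0) + μ
  /-- The Hessian of `H` at `θs` is negative definite on the critical cone. -/
  neg_def : ∀ d : Fin (k + 1) → ℝ, d ≠ 0 → ∑ i, d i = 0 →
    (∀ i : Fin (k + 1), (i : ℕ) < m → d i = 0) →
    fderiv ℝ (fderiv ℝ (realVersion H)) θs d d < 0

/-- The simplex truncated near the faces `{θᵢ = 0}` with `θsᵢ > 0`. -/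
def truncSimplex {k : ℕ} (θs : Fin (k + 1) → ℝ) (ε : ℝ) : Set (Fin (k + 1) → ℝ) :=
  {θ | θ ∈ simplex k ∧ ∀ i, 0 < θs i → ε ≤ θ i}

/-- `X 0, …, X (N - 1)` are independent random vectors with common law `ν`. -/
def IsIIDSample {Ω : Type*} [MeasurableSpace Ω] {k N : ℕ} (X : Fin N → Ω → Fin (k + 1) → ℝ)
    (ν : Measure (Fin (k + 1) → ℝ)) (P : Measure Ω) : Prop :=
  (∀ i, HasLaw (X i) ν P) ∧ iIndepFun X P

/-- The parameter `α + n^γ θs` of the importance sampling proposal. -/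
noncomputable def proposalParam {k : ℕ} (α θs : Fin (k + 1) → ℝ) (γ n : ℝ) : Fin (k + 1) → ℝ :=
  fun i => α i + n ^ γ * θs i

/-- The standard Monte Carlo estimator `N⁻¹ ∑ e^{n H(Xᵢ)}`. -/
noncomputable def mcEstimator {Ω : Type*} {k N : ℕ} (H : (Fin (k + 1) → ℝ) → EReal) (n : ℝ)
    (X : Fin N → Ω → Fin (k + 1) → ℝ) (ω : Ω) : ℝ :=
  1 / (N : ℝ) * ∑ i, expScaled n (H (X i ω))

/-- The truncated importance sampling estimator
`N⁻¹ ∑ e^{n H(Xᵢ)} (Dir_α(Xᵢ) / Dir_{α + n^γ θs}(Xᵢ)) 1_{Δ^ε}(Xᵢ)`. -/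
noncomputable def isEstimator {Ω : Type*} {k N : ℕ} (H : (Fin (k + 1) → ℝ) → EReal)
    (α θs : Fin (k + 1) → ℝ) (γ ε n : ℝ) (X : Fin N → Ω → Fin (k + 1) → ℝ) (ω : Ω) : ℝ :=
  1 / (N : ℝ) * ∑ i, expScaled n (H (X i ω)) *
    (dirichletDensity α (X i ω) / dirichletDensity (proposalParam α θs γ n) (X i ω)) *
    (truncSimplex θs ε).indicator 1 (X i ω)

end DirichletIS

namespace DirichletIS

open Set Topology

variable {k : ℕ}

/-! Everything reduces to one Laplace scale. Write `p = decayRate α θs`: each zero coordinate of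
`θs` contributes its `α i` and every other coordinate except the last contributes `1/2`. Integrals
of `exp (-t * gap)` against `dirichlet α` are of order `t ^ (-p)`, because the region with `t * gap`
bounded has width `1/t` in the zero directions, where the density behaves like `x ^ (α i - 1)`, and
width `1/√t` in the others (`exists_integral_exp_neg_gap_le`, `exists_le_setIntegral_exp_neg_gap`).

Two functions are comparable to `gap`. The deficit of `H` is: strict complementarity gives the
linear part, negative definiteness on the critical cone the quadratic part, and compactness with
uniqueness of the maximizer makes the upper bound on `H` global (`Assumptions.exists_le_sub_gap`).
So is the divergence `klGap`, whose upper bound by `gap` needs the truncation (`gap_le_klGap`,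
`klGap_le_gap`).

With `s = n ^ γ`, the proposal is `dirichlet α` tilted by `exp (-s * klGap)` and normalised by `Z(s)
= ∫ exp (-s * klGap)`, of order `s ^ (-p)`. One of the two weights in the second moment cancels the
change of measure, leaving `Z(s) * ∫ exp (2nH + s * klGap)` on the truncated simplex. As `s = o(n)`,
the tilt does not change the order `n ^ (-p)` of the integral, normalised by the squared maximum.
The second moments are thus of orders `n ^ (-γp - p)` for importance sampling and `n ^ (-p)` for
Monte Carlo. The squared means are `O(n ^ (-2p))`, negligible since `p > 0` and `γ < 1`, so the
quotient is of order `n ^ (-γp)`. -/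

/-! ### The coordinate chart of the simplex and Dirichlet integrals. -/

theorem coordMap_castSucc (y : Fin k → ℝ) (i : Fin k) : coordMap y i.castSucc = y i := by
  simp [coordMap]

theorem coordMap_last (y : Fin k → ℝ) : coordMap y (Fin.last k) = 1 - ∑ i, y i := by
  simp [coordMap]

theorem sum_coordMap (y : Fin k → ℝ) : ∑ i, coordMap y i = 1 := by
  rw [Fin.sum_univ_castSucc]
  simp [coordMap_castSucc, coordMap_last]

theorem coordMap_mem_simplex_iff (y : Fin k → ℝ) :
    coordMap y ∈ simplex k ↔ y ∈ projSimplex k := by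
  simp only [simplex, projSimplex, mem_ofPred_eq, sum_coordMap, and_true, Fin.forall_fin_succ',
    coordMap_castSucc, coordMap_last, sub_nonneg]

theorem continuous_coordMap : Continuous (coordMap : (Fin k → ℝ) → Fin (k + 1) → ℝ) := by
  refine continuous_pi fun i => ?_
  induction i using Fin.lastCases with
  | last => simp only [coordMap_last]; fun_prop
  | cast i => simp only [coordMap_castSucc]; fun_prop

theorem coordMap_injective : Function.Injective (coordMap : (Fin k → ℝ) → Fin (k + 1) → ℝ) := by
  intro y z h
  ext i
  rw [← coordMap_castSucc y, h, coordMap_castSucc]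

theorem measurableEmbedding_coordMap :
    MeasurableEmbedding (coordMap : (Fin k → ℝ) → Fin (k + 1) → ℝ) :=
  continuous_coordMap.measurableEmbedding coordMap_injective

theorem isClosed_simplex : IsClosed (simplex k) := by
  simp only [simplex, ofPred_and, ofPred_forall]
  exact (isClosed_iInter fun i => isClosed_le continuous_const (continuous_apply i)).inter
    (isClosed_eq (by fun_prop) continuous_const)

theorem le_one_of_mem_simplex {θ : Fin (k + 1) → ℝ} (h : θ ∈ simplex k) (i : Fin (k + 1)) :
    θ i ≤ 1 :=
  h.2 ▸ Finset.single_le_sum (fun j _ => h.1 j) (Finset.mem_univ i)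

theorem isCompact_simplex : IsCompact (simplex k) := by
  refine (isCompact_univ_pi fun _ : Fin (k + 1) =>
    isCompact_Icc (a := (0 : ℝ)) (b := 1)).of_isClosed_subset isClosed_simplex fun θ hθ i _ => ⟨hθ.1 i, le_one_of_mem_simplex hθ i⟩

theorem isClosed_projSimplex : IsClosed (projSimplex k) := by
  have : projSimplex k = coordMap ⁻¹' simplex k := by
    ext y; exact (coordMap_mem_simplex_iff y).symm
  exact this ▸ isClosed_simplex.preimage continuous_coordMap

theorem multiBeta_pos {α : Fin (k + 1) → ℝ} (hα : ∀ i, 0 < α i) : 0 < multiBeta α :=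
  div_pos (Finset.prod_pos fun i _ => Real.Gamma_pos_of_pos (hα i))
    (Real.Gamma_pos_of_pos (Finset.sum_pos (fun i _ => hα i) Finset.univ_nonempty))

theorem measurable_dirichletDensity (α : Fin (k + 1) → ℝ) : Measurable (dirichletDensity α) := by
  unfold dirichletDensity
  fun_prop

theorem dirichletDensity_nonneg {α : Fin (k + 1) → ℝ} (hα : ∀ i, 0 < α i)
    {θ : Fin (k + 1) → ℝ} (hθ : ∀ i, 0 ≤ θ i) : 0 ≤ dirichletDensity α θ :=
  mul_nonneg (one_div_nonneg.2 (multiBeta_pos hα).le)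
    (Finset.prod_nonneg fun i _ => Real.rpow_nonneg (hθ i) _)

theorem integral_dirichlet {α : Fin (k + 1) → ℝ} (hα : ∀ i, 0 < α i)
    (f : (Fin (k + 1) → ℝ) → ℝ) :
    ∫ θ, f θ ∂dirichlet α =
      ∫ y in projSimplex k, dirichletDensity α (coordMap y) * f (coordMap y) := by
  rw [dirichlet, measurableEmbedding_coordMap.integral_map,
    integral_withDensity_eq_integral_toReal_smul₀]
  · refine setIntegral_congr_fun isClosed_projSimplex.measurableSet fun y hy => ?_
    rw [smul_eq_mul, ENNReal.toReal_ofReal]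
    exact dirichletDensity_nonneg hα ((coordMap_mem_simplex_iff y).2 hy).1
  · exact ((measurable_dirichletDensity α).comp
      measurableEmbedding_coordMap.measurable).ennreal_ofReal.aemeasurable
  · exact ae_of_all _ fun _ => ENNReal.ofReal_lt_top

theorem integrable_dirichlet_iff {α : Fin (k + 1) → ℝ} (hα : ∀ i, 0 < α i)
    (f : (Fin (k + 1) → ℝ) → ℝ) :
    Integrable f (dirichlet α) ↔ IntegrableOn
      (fun y => dirichletDensity α (coordMap y) * f (coordMap y)) (projSimplex k) := by
  rw [dirichlet, measurableEmbedding_coordMap.integrable_map_iff,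
    integrable_withDensity_iff_integrable_smul₀']
  · refine integrable_congr ?_
    filter_upwards [ae_restrict_mem isClosed_projSimplex.measurableSet] with y hy
    rw [smul_eq_mul, ENNReal.toReal_ofReal, Function.comp]
    exact dirichletDensity_nonneg hα ((coordMap_mem_simplex_iff y).2 hy).1
  · exact ((measurable_dirichletDensity α).comp
      measurableEmbedding_coordMap.measurable).ennreal_ofReal.aemeasurable
  · exact ae_of_all _ fun _ => ENNReal.ofReal_lt_top

theorem ae_dirichlet_of_ae {α : Fin (k + 1) → ℝ} {p : (Fin (k + 1) → ℝ) → Prop}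
    (h : ∀ᵐ y ∂(volume : Measure (Fin k → ℝ)).restrict (projSimplex k), p (coordMap y)) :
    ∀ᵐ θ ∂dirichlet α, p θ := by
  rw [dirichlet, measurableEmbedding_coordMap.ae_map_iff]
  exact withDensity_absolutelyContinuous _ _ h

theorem volume_sum_eq_one : volume {y : Fin k → ℝ | ∑ i, y i = 1} = 0 := by
  let A : AffineSubspace ℝ (Fin k → ℝ) :=
    { carrier := {y | ∑ i, y i = 1}
      smul_vsub_vadd_mem' := fun c p₁ p₂ p₃ h₁ h₂ h₃ => by
        simp only [mem_ofPred_eq] at *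
        simp [Finset.sum_add_distrib, ← Finset.mul_sum, h₁, h₂, h₃] }
  -- A proper affine subspace is Haar-null; this one is proper because it misses the origin.
  refine Measure.addHaar_affineSubspace volume A fun h => ?_
  have : (0 : Fin k → ℝ) ∈ A := h ▸ AffineSubspace.mem_top ℝ _ _
  have : ∑ i : Fin k, (0 : Fin k → ℝ) i = 1 := this
  simp at this

/-- The boundary faces lie in finitely many hyperplanes. Discarding them makes all coordinates
positive, as required for adding real exponents and for rewriting powers through logarithms. -/
theorem ae_coordMap_pos :
    ∀ᵐ y ∂(volume : Measure (Fin k → ℝ)).restrict (projSimplex k), ∀ i, 0 < coordMap y i := by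
  have h1 : ∀ᵐ y : Fin k → ℝ, ∑ i, y i ≠ 1 := by
    rw [ae_iff]; simpa using volume_sum_eq_one
  have h2 : ∀ᵐ y : Fin k → ℝ, ∀ i, y i ≠ 0 := by
    rw [ae_all_iff]
    intro i
    rw [ae_iff]
    simpa [volume_pi] using Measure.pi_hyperplane (fun _ : Fin k => (volume : Measure ℝ)) i 0
  filter_upwards [ae_restrict_mem isClosed_projSimplex.measurableSet,
    ae_restrict_of_ae h1, ae_restrict_of_ae h2] with y hy h1 h2 i
  refine lt_of_le_of_ne (((coordMap_mem_simplex_iff y).2 hy).1 i) ?_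
  induction i using Fin.lastCases with
  | last => rw [coordMap_last]; intro h; exact h1 (by linarith)
  | cast i => rw [coordMap_castSucc]; exact (h2 i).symm

theorem ae_mem_simplex (α : Fin (k + 1) → ℝ) : ∀ᵐ θ ∂dirichlet α, θ ∈ simplex k :=
  ae_dirichlet_of_ae <| by
    filter_upwards [ae_restrict_mem isClosed_projSimplex.measurableSet] with y hy
    exact (coordMap_mem_simplex_iff y).2 hy

theorem ae_pos (α : Fin (k + 1) → ℝ) : ∀ᵐ θ ∂dirichlet α, ∀ i, 0 < θ i :=
  ae_dirichlet_of_ae ae_coordMap_pos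

/-- Densities of Dirichlet distributions with respect to each other. -/
theorem dirichletDensity_add {α s θ : Fin (k + 1) → ℝ} (hα : ∀ i, 0 < α i) (hθ : ∀ i, 0 < θ i) :
    dirichletDensity (α + s) θ =
      multiBeta α / multiBeta (α + s) * (∏ i, θ i ^ s i) * dirichletDensity α θ := by
  have h : ∏ i, θ i ^ ((α + s) i - 1) = (∏ i, θ i ^ s i) * ∏ i, θ i ^ (α i - 1) := by
    rw [← Finset.prod_mul_distrib]
    refine Finset.prod_congr rfl fun i _ => ?_
    rw [← Real.rpow_add (hθ i), Pi.add_apply]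
    congr 1
    ring
  have := (multiBeta_pos hα).ne'
  rw [dirichletDensity, dirichletDensity, h]
  field_simp

theorem integral_dirichlet_add {α s : Fin (k + 1) → ℝ} (hα : ∀ i, 0 < α i)
    (hs : ∀ i, 0 ≤ s i) (f : (Fin (k + 1) → ℝ) → ℝ) :
    ∫ θ, f θ ∂dirichlet (α + s) =
      multiBeta α / multiBeta (α + s) * ∫ θ, (∏ i, θ i ^ s i) * f θ ∂dirichlet α := by
  have hαs : ∀ i, 0 < (α + s) i := fun i => add_pos_of_pos_of_nonneg (hα i) (hs i)
  rw [integral_dirichlet hα, integral_dirichlet hαs, ← integral_const_mul]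
  refine integral_congr_ae ?_
  filter_upwards [ae_coordMap_pos] with y hy
  rw [dirichletDensity_add hα hy]
  ring

/-! ### Two-sided Laplace estimates for the gap function. -/

/-- The gap function comparing `θ` with `θs`: linear in the coordinates vanishing at `θs`, and
quadratic in all coordinates. -/
noncomputable def gap (θs θ : Fin (k + 1) → ℝ) : ℝ :=
  ∑ i, (if θs i = 0 then θ i else 0) + ∑ i, (θ i - θs i) ^ 2

/-- The contribution of one coordinate to the polynomial decay of Laplace integrals. -/
noncomputable def coordRate (a c : ℝ) : ℝ := if c = 0 then a else 1 / 2

/-- The exponent of the polynomial decay of `∫ exp (-t * gap θs θ) ∂dirichlet α`. -/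
noncomputable def decayRate (α θs : Fin (k + 1) → ℝ) : ℝ :=
  ∑ i : Fin k, coordRate (α i.castSucc) (θs i.castSucc)

theorem continuous_gap (θs : Fin (k + 1) → ℝ) : Continuous (gap θs) := by
  unfold gap
  refine .add (continuous_finsetSum _ fun i _ => ?_) (by fun_prop)
  split_ifs <;> fun_prop

theorem gap_nonneg (θs : Fin (k + 1) → ℝ) {θ : Fin (k + 1) → ℝ} (hθ : θ ∈ simplex k) :
    0 ≤ gap θs θ :=
  add_nonneg (Finset.sum_nonneg fun i _ => by split_ifs <;> simp [hθ.1 i])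
    (Finset.sum_nonneg fun i _ => sq_nonneg _)

theorem integrable_exp_neg_gap (α θs : Fin (k + 1) → ℝ) [IsFiniteMeasure (dirichlet α)]
    {t : ℝ} (ht : 0 ≤ t) : Integrable (fun θ => Real.exp (-t * gap θs θ)) (dirichlet α) := by
  refine Integrable.of_bound (C := 1)
    (by have := continuous_gap θs; fun_prop) ?_
  filter_upwards [ae_mem_simplex α] with θ hθ
  rw [Real.norm_eq_abs, Real.abs_exp, Real.exp_le_one_iff]
  nlinarith [gap_nonneg θs hθ]

/-- A one-dimensional integrand dominating the coordinates of the Laplace integral. -/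
noncomputable def envelope (a c t x : ℝ) : ℝ :=
  if c = 0 then (Ioi 0).indicator (fun x => x ^ (a - 1) * Real.exp (-(t * x))) x
  else Real.exp (-t * (x - c) ^ 2)

theorem integrable_envelope {a t : ℝ} (c : ℝ) (ha : 0 < a) (ht : 0 < t) :
    Integrable (envelope a c t) := by
  unfold envelope
  split_ifs
  · rw [integrable_indicator_iff measurableSet_Ioi]
    have := integrableOn_rpow_mul_exp_neg_mul_rpow (s := a - 1) (p := 1) (b := t) (by linarith)
      one_pos ht
    simpa using this
  · exact (integrable_exp_neg_mul_sq ht).comp_sub_right c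

theorem integral_envelope {a t : ℝ} (c : ℝ) (ha : 0 < a) (ht : 0 < t) :
    ∫ x, envelope a c t x = (if c = 0 then Real.Gamma a else √Real.pi) * t ^ (-coordRate a c) := by
  unfold envelope coordRate
  split_ifs
  · rw [integral_indicator measurableSet_Ioi, Real.integral_rpow_mul_exp_neg_mul_Ioi ha ht,
      one_div, Real.inv_rpow ht.le, Real.rpow_neg ht.le, mul_comm]
  · rw [integral_sub_right_eq_self (fun x => Real.exp (-t * x ^ 2)) c, integral_gaussian,
      Real.sqrt_div Real.pi_pos.le, Real.rpow_neg ht.le, ← Real.sqrt_eq_rpow, div_eq_mul_inv]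

/-- A one-dimensional interval around `c` on which the Laplace integrand is of constant order. -/
noncomputable def box (c η t : ℝ) : Set ℝ :=
  if c = 0 then Ioc 0 (η / t) else Ioc (c - η / √t) (c + η / √t)

/-- A one-dimensional integrand dominated by the coordinates of the Laplace integral. -/
noncomputable def boxKernel (a c η t x : ℝ) : ℝ :=
  (box c η t).indicator (fun x => if c = 0 then x ^ (a - 1) else 1) x

theorem integrable_boxKernel {a t η : ℝ} (c : ℝ) (ha : 0 < a) (ht : 0 < t) (hη : 0 < η) :
    Integrable (boxKernel a c η t) := by
  unfold boxKernel box
  split_ifs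
  · rw [integrable_indicator_iff measurableSet_Ioc,
      ← intervalIntegrable_iff_integrableOn_Ioc_of_le (by positivity)]
    exact intervalIntegral.intervalIntegrable_rpow' (by linarith)
  · rw [integrable_indicator_iff measurableSet_Ioc]
    simp

theorem integral_boxKernel {a t η : ℝ} (c : ℝ) (ha : 0 < a) (ht : 0 < t) (hη : 0 < η) :
    ∫ x, boxKernel a c η t x =
      (if c = 0 then η ^ a / a else 2 * η) * t ^ (-coordRate a c) := by
  unfold boxKernel box coordRate
  split_ifs
  · rw [integral_indicator measurableSet_Ioc,
      ← intervalIntegral.integral_of_le (by positivity), integral_rpow (Or.inl (by linarith))]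
    rw [sub_add_cancel, Real.zero_rpow ha.ne', Real.div_rpow hη.le ht.le, Real.rpow_neg ht.le]
    ring
  · rw [integral_indicator measurableSet_Ioc, Real.rpow_neg ht.le, ← Real.sqrt_eq_rpow]
    have : (0 : ℝ) ≤ 2 * (η / √t) := by positivity
    simp [Measure.real, Real.volume_Ioc]
    ring_nf
    rw [ENNReal.toReal_ofReal (by positivity)]

theorem prod_rpow_neg_coordRate (α θs : Fin (k + 1) → ℝ) {t : ℝ} (ht : 0 < t) (A : Fin k → ℝ) :
    ∏ i : Fin k, (A i * t ^ (-coordRate (α i.castSucc) (θs i.castSucc))) =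
      (∏ i, A i) * t ^ (-decayRate α θs) := by
  rw [Finset.prod_mul_distrib, ← Real.rpow_sum_of_pos ht, decayRate, Finset.sum_neg_distrib]

/-- The absolute value treats both signs of the exponent at once. -/
theorem rpow_bounds {a x : ℝ} (p : ℝ) (ha : 0 < a) (hax : a ≤ x) (hx : x ≤ 1) :
    a ^ |p| ≤ x ^ p ∧ x ^ p ≤ (a ^ |p|)⁻¹ := by
  have hx0 := ha.trans_le hax
  constructor
  · exact (Real.rpow_le_rpow ha.le hax (abs_nonneg p)).trans
      (Real.rpow_le_rpow_of_exponent_ge hx0 hx (le_abs_self p))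
  · rw [← Real.rpow_neg ha.le]
    exact (Real.rpow_le_rpow_of_exponent_ge hx0 hx (neg_abs_le p)).trans
      (Real.rpow_le_rpow_of_nonpos ha hax (by simp))

/-- Coordinates with `θs i ≠ 0` stay between `θs i / 2` and `1`, so their factors are of constant
order. The last coordinate is one of them, which leaves a product of functions of the `k` free
coordinates. -/
theorem exists_dirichletDensity_bounds {α θs : Fin (k + 1) → ℝ} (hα : ∀ i, 0 < α i)
    (hlast : 0 < θs (Fin.last k)) :
    ∃ M > 0, ∀ θ ∈ simplex k, (∀ i, θs i ≠ 0 → θs i / 2 ≤ θ i) → (∀ i, 0 ≤ θs i) →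
      M⁻¹ * ∏ i : Fin k, (if θs i.castSucc = 0 then θ i.castSucc ^ (α i.castSucc - 1) else 1) ≤
        dirichletDensity α θ ∧ dirichletDensity α θ ≤
      M * ∏ i : Fin k, (if θs i.castSucc = 0 then θ i.castSucc ^ (α i.castSucc - 1) else 1) := by
  let b : Fin (k + 1) → ℝ := fun i => if 0 < θs i then (θs i / 2) ^ |α i - 1| else 1
  have hb : ∀ i, 0 < b i := fun i => by
    simp only [b]; split_ifs with h
    · exact Real.rpow_pos_of_pos (by linarith) _
    · exact one_pos
  have hB := multiBeta_pos hα
  have hP : 0 < ∏ i, b i := Finset.prod_pos fun i _ => hb i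
  refine ⟨max (multiBeta α / ∏ i, b i) (1 / multiBeta α * (∏ i, b i)⁻¹),
    lt_max_of_lt_left (by positivity),
    fun θ hθ hhalf hθs => ?_⟩
  set w : Fin (k + 1) → ℝ := fun i => if θs i = 0 then θ i ^ (α i - 1) else 1 with hw
  have hw0 : ∀ i, 0 ≤ w i := fun i => by
    simp only [hw]; split_ifs
    · exact Real.rpow_nonneg (hθ.1 i) _
    · exact zero_le_one
  have hprod : ∏ i : Fin k, (if θs i.castSucc = 0 then θ i.castSucc ^ (α i.castSucc - 1) else 1) =
      ∏ i, w i := by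
    rw [Fin.prod_univ_castSucc w]
    simp [hw, hlast.ne']
  have hw1 : 0 ≤ ∏ i, w i := Finset.prod_nonneg fun i _ => hw0 i
  have hbounds : ∀ i, b i * w i ≤ θ i ^ (α i - 1) ∧ θ i ^ (α i - 1) ≤ (b i)⁻¹ * w i := fun i => by
    by_cases h : θs i = 0
    · simp [b, hw, h]
    · have hpos : 0 < θs i := lt_of_le_of_ne (hθs i) (Ne.symm h)
      simpa [b, hw, h, hpos] using
        rpow_bounds (α i - 1) (half_pos hpos) (hhalf i h) (le_one_of_mem_simplex hθ i)
  rw [hprod, dirichletDensity]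
  constructor
  · calc _ ≤ (multiBeta α / ∏ i, b i)⁻¹ * ∏ i, w i := by
          gcongr; exact le_max_left _ _
      _ = 1 / multiBeta α * ∏ i, (b i * w i) := by
          rw [Finset.prod_mul_distrib]; field_simp
      _ ≤ _ := by
          gcongr with i
          · exact fun i _ => mul_nonneg (hb i).le (hw0 i)
          · exact (hbounds i).1
  · calc _ ≤ 1 / multiBeta α * ∏ i, ((b i)⁻¹ * w i) := by
          gcongr with i
          · exact fun i _ => Real.rpow_nonneg (hθ.1 i) _
          · exact (hbounds i).2
      _ = 1 / multiBeta α * (∏ i, b i)⁻¹ * ∏ i, w i := by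
          rw [Finset.prod_mul_distrib, Finset.prod_inv_distrib]; ring
      _ ≤ _ := by
          gcongr; exact le_max_right _ _

theorem exists_pos_le_of_pos (θs : Fin (k + 1) → ℝ) :
    ∃ r > 0, ∀ i, 0 < θs i → r ≤ θs i := by
  have : ∀ᶠ r in nhdsWithin (0 : ℝ) (Ioi 0), ∀ i, 0 < θs i → r ≤ θs i := by
    rw [eventually_all]
    intro i
    by_cases h : 0 < θs i
    · filter_upwards [Ioo_mem_nhdsGT h] with r hr _ using hr.2.le
    · simp [h]
  obtain ⟨r, hr, h⟩ := (this.and self_mem_nhdsWithin).exists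
  exact ⟨r, h, hr⟩

/-- Dropping the last coordinate and the squares at zero coordinates leaves a sum of one-variable
functions, so the exponential factorises and Fubini applies. -/
theorem sum_le_gap (θs : Fin (k + 1) → ℝ) {θ : Fin (k + 1) → ℝ} (hθ : θ ∈ simplex k) :
    ∑ i : Fin k, (if θs i.castSucc = 0 then θ i.castSucc else (θ i.castSucc - θs i.castSucc) ^ 2) ≤
      gap θs θ := by
  rw [gap, ← Finset.sum_add_distrib, Fin.sum_univ_castSucc]
  refine le_add_of_le_of_nonneg (Finset.sum_le_sum fun i _ => ?_) ?_
  · split_ifs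
    · nlinarith [sq_nonneg (θ i.castSucc - θs i.castSucc)]
    · simp
  · have := hθ.1 (Fin.last k)
    split_ifs <;> positivity

theorem sq_le_gap (θs : Fin (k + 1) → ℝ) {θ : Fin (k + 1) → ℝ} (hθ : θ ∈ simplex k)
    (i : Fin (k + 1)) : (θ i - θs i) ^ 2 ≤ gap θs θ :=
  (Finset.single_le_sum (f := fun i => (θ i - θs i) ^ 2) (fun i _ => sq_nonneg _)
    (Finset.mem_univ i)).trans (le_add_of_nonneg_left
      (Finset.sum_nonneg fun i _ => by split_ifs <;> simp [hθ.1 i]))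

theorem prod_mul_exp_eq_envelope (α θs θ : Fin (k + 1) → ℝ) (hθ : ∀ i, 0 < θ i) (t : ℝ) :
    (∏ i : Fin k, (if θs i.castSucc = 0 then θ i.castSucc ^ (α i.castSucc - 1) else 1)) *
      Real.exp (-t * ∑ i : Fin k,
        (if θs i.castSucc = 0 then θ i.castSucc else (θ i.castSucc - θs i.castSucc) ^ 2)) =
      ∏ i : Fin k, envelope (α i.castSucc) (θs i.castSucc) t (θ i.castSucc) := by
  rw [Finset.mul_sum, Real.exp_sum, ← Finset.prod_mul_distrib]
  refine Finset.prod_congr rfl fun i _ => ?_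
  unfold envelope
  split_ifs
  · rw [indicator_of_mem (mem_Ioi.2 (hθ _)), neg_mul]
  · rw [one_mul]

/-- Near `θs` the integrand is below a product of envelopes, integrable over all of `ℝ^k` with exact
power scaling. Elsewhere some coordinate has moved by at least `r / 2`, so the integrand is
exponentially small times a probability density. -/
theorem exists_integral_exp_neg_gap_le {α θs : Fin (k + 1) → ℝ} (hα : ∀ i, 0 < α i)
    [IsProbabilityMeasure (dirichlet α)] (hθs : ∀ i, 0 ≤ θs i) (hlast : 0 < θs (Fin.last k)) :
    ∃ C > 0, ∀ᶠ t in atTop,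
      ∫ θ, Real.exp (-t * gap θs θ) ∂dirichlet α ≤ C * t ^ (-decayRate α θs) := by
  obtain ⟨M, hM, hdens⟩ := exists_dirichletDensity_bounds hα hlast
  obtain ⟨r, hr, hrθ⟩ := exists_pos_le_of_pos θs
  set A : Fin k → ℝ := fun i =>
    if θs i.castSucc = 0 then Real.Gamma (α i.castSucc) else √Real.pi with hA
  have hApos : ∀ i, 0 < A i := fun i => by
    simp only [hA]; split_ifs
    · exact Real.Gamma_pos_of_pos (hα _)
    · exact Real.sqrt_pos.2 Real.pi_pos
  have hsmall := (isLittleO_exp_neg_mul_rpow_atTop (a := (r / 2) ^ 2) (by positivity)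
    (-decayRate α θs)).bound one_pos
  have hprod : 0 < ∏ i, A i := Finset.prod_pos fun i _ => hApos i
  -- The summand `1` pays for the exponentially small far part.
  refine ⟨M * ∏ i, A i + 1, by positivity, ?_⟩
  filter_upwards [hsmall, eventually_gt_atTop 0] with t ht ht0
  set E : (Fin k → ℝ) → ℝ := fun y =>
    M * ∏ i : Fin k, envelope (α i.castSucc) (θs i.castSucc) t (y i) with hE
  have hEint : Integrable E :=
    (Integrable.fintype_prod fun i => integrable_envelope _ (hα _) ht0).const_mul M
  have hE0 : ∀ y, 0 ≤ E y := fun y => mul_nonneg hM.le <| Finset.prod_nonneg fun i _ => by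
    unfold envelope
    split_ifs
    · exact indicator_nonneg (fun x (hx : 0 < x) =>
        mul_nonneg (Real.rpow_nonneg hx.le _) (Real.exp_pos _).le) _
    · exact (Real.exp_pos _).le
  have hEval : ∫ y, E y = M * ((∏ i, A i) * t ^ (-decayRate α θs)) := by
    rw [integral_const_mul, integral_fintype_prod_volume_eq_prod
      (fun i x => envelope (α (Fin.castSucc i)) (θs i.castSucc) t x),
      ← prod_rpow_neg_coordRate α θs ht0]
    congr 1
    exact Finset.prod_congr rfl fun i _ => integral_envelope _ (hα _) ht0
  have hDint : IntegrableOn (fun y => dirichletDensity α (coordMap y)) (projSimplex k) := by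
    simpa using (integrable_dirichlet_iff hα (fun _ => 1)).1 (integrable_const 1)
  have hDval : ∫ y in projSimplex k, dirichletDensity α (coordMap y) = 1 := by
    simpa using (integral_dirichlet hα (fun _ => 1)).symm
  rw [integral_dirichlet hα]
  calc _ ≤ ∫ y in projSimplex k,
        (E y + Real.exp (-(r / 2) ^ 2 * t) * dirichletDensity α (coordMap y)) := by
        refine integral_mono_ae ((integrable_dirichlet_iff hα _).1
          (integrable_exp_neg_gap α θs ht0.le)) (hEint.restrict.add (hDint.const_mul _)) ?_
        filter_upwards [ae_restrict_mem isClosed_projSimplex.measurableSet, ae_coordMap_pos]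
          with y hy hpos
        have hs := (coordMap_mem_simplex_iff y).2 hy
        have hd0 := dirichletDensity_nonneg hα hs.1
        by_cases hnear : ∀ i, θs i ≠ 0 → θs i / 2 ≤ coordMap y i
        · refine le_add_of_le_of_nonneg ?_ (by positivity)
          calc _ ≤ (M * ∏ i : Fin k, (if θs i.castSucc = 0 then
                  coordMap y i.castSucc ^ (α i.castSucc - 1) else 1)) *
                Real.exp (-t * ∑ i : Fin k, (if θs i.castSucc = 0 then coordMap y i.castSucc
                  else (coordMap y i.castSucc - θs i.castSucc) ^ 2)) := by
                refine mul_le_mul (hdens _ hs hnear hθs).2 (Real.exp_le_exp.2 ?_)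
                  (Real.exp_pos _).le (hd0.trans (hdens _ hs hnear hθs).2)
                have := sum_le_gap θs hs
                nlinarith
            _ = _ := by
                rw [mul_assoc, prod_mul_exp_eq_envelope α θs _ hpos]
                simp [hE, coordMap_castSucc]
        · push Not at hnear
          obtain ⟨i, hi, hlt⟩ := hnear
          have hri := hrθ i (lt_of_le_of_ne (hθs i) (Ne.symm hi))
          refine le_add_of_nonneg_of_le (hE0 y) ?_
          rw [mul_comm]
          refine mul_le_mul_of_nonneg_right (Real.exp_le_exp.2 ?_) hd0
          have h1 := sq_le_gap θs hs i
          have h2 : (r / 2) ^ 2 ≤ (coordMap y i - θs i) ^ 2 := by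
            nlinarith
          nlinarith [h1, h2]
    _ ≤ M * ((∏ i, A i) * t ^ (-decayRate α θs)) + Real.exp (-(r / 2) ^ 2 * t) := by
        rw [integral_add hEint.restrict (hDint.const_mul _),
          integral_const_mul _ (fun y => dirichletDensity α (coordMap y)), hDval, mul_one,
          ← hEval]
        exact add_le_add (setIntegral_le_integral hEint (ae_of_all _ hE0)) le_rfl
    _ ≤ _ := by
        rw [Real.norm_of_nonneg (Real.exp_pos _).le,
          Real.norm_of_nonneg (Real.rpow_nonneg ht0.le _), one_mul] at ht
        linarith

/-- It suffices to integrate over the box of side of order `1/t` in zero directions and `1/√t` in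
the others: there `t * gap ≤ C₀` and the density is bounded below by the kernel. -/
theorem exists_le_setIntegral_exp_neg_gap {α θs : Fin (k + 1) → ℝ} (hα : ∀ i, 0 < α i)
    [IsProbabilityMeasure (dirichlet α)] (hθs : θs ∈ simplex k) (hlast : 0 < θs (Fin.last k))
    {δ : ℝ} (hδ : 0 < δ) :
    ∃ C > 0, ∀ᶠ t in atTop,
      C * t ^ (-decayRate α θs) ≤
        ∫ θ in Metric.ball θs δ, Real.exp (-t * gap θs θ) ∂dirichlet α := by
  obtain ⟨M, hM, hdens⟩ := exists_dirichletDensity_bounds hα hlast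
  obtain ⟨r, hr, hrθ⟩ := exists_pos_le_of_pos θs
  have hk : (0 : ℝ) < k + 1 := by positivity
  -- The last coordinate collects the deviations of the other `k`, hence the factor `k + 1`. The two
  -- bounds keep the box inside the ball and every positive coordinate above half its value.
  obtain ⟨η, hη, hηδ, hηr⟩ : ∃ η > 0, (k + 1) * η < δ ∧ (k + 1) * η ≤ r / 2 := by
    refine ⟨min (δ / 2) (r / 2) / (k + 1), by positivity, ?_, ?_⟩
    · rw [mul_div_cancel₀ _ hk.ne']
      exact (min_le_left _ _).trans_lt (by linarith)
    · rw [mul_div_cancel₀ _ hk.ne']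
      exact min_le_right _ _
  set A : Fin k → ℝ := fun i =>
    if θs i.castSucc = 0 then η ^ α i.castSucc / α i.castSucc else 2 * η with hA
  have hApos : ∀ i, 0 < A i := fun i => by
    have := hα i.castSucc
    simp only [hA]; split_ifs <;> positivity
  set C₀ : ℝ := (k + 1) * η + (k + 1) * ((k + 1) * η) ^ 2 with hC₀
  refine ⟨M⁻¹ * Real.exp (-C₀) * ∏ i, A i,
    by have := Finset.prod_pos fun i (_ : i ∈ Finset.univ) => hApos i; positivity, ?_⟩
  filter_upwards [eventually_ge_atTop 1] with t ht1
  have ht0 : 0 < t := one_pos.trans_le ht1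
  have hst : 1 ≤ √t := Real.one_le_sqrt.2 ht1
  have hst2 : √t ^ 2 = t := Real.sq_sqrt ht0.le
  have hηt : η / t ≤ η / √t := by
    gcongr; nlinarith
  have hηt1 : η / √t ≤ η := div_le_self hη.le hst
  have hηt0 : 0 ≤ η / √t := by positivity
  set E : (Fin k → ℝ) → ℝ := fun y =>
    M⁻¹ * Real.exp (-C₀) * ∏ i : Fin k, boxKernel (α i.castSucc) (θs i.castSucc) η t (y i) with hE
  have hEint : Integrable E :=
    (Integrable.fintype_prod fun i => integrable_boxKernel _ (hα _) ht0 hη).const_mul _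
  have hEval : ∫ y, E y = M⁻¹ * Real.exp (-C₀) * (∏ i, A i) * t ^ (-decayRate α θs) := by
    rw [integral_const_mul, integral_fintype_prod_volume_eq_prod
      (fun i x => boxKernel (α (Fin.castSucc i)) (θs i.castSucc) η t x),
      mul_assoc (M⁻¹ * Real.exp (-C₀)) (∏ i, A i),
      ← prod_rpow_neg_coordRate α θs ht0]
    congr 1
    exact Finset.prod_congr rfl fun i _ => integral_boxKernel _ (hα _) ht0 hη
  rw [← integral_indicator Metric.isOpen_ball.measurableSet, integral_dirichlet hα,
    ← integral_indicator isClosed_projSimplex.measurableSet, ← hEval]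
  refine integral_mono hEint ((integrable_indicator_iff isClosed_projSimplex.measurableSet).2
    ((integrable_dirichlet_iff hα _).1 ((integrable_exp_neg_gap α θs ht0.le).indicator
      Metric.isOpen_ball.measurableSet))) fun y => ?_
  by_cases hbox : ∀ i : Fin k, y i ∈ box (θs i.castSucc) η t
  swap
  · push Not at hbox
    obtain ⟨i, hi⟩ := hbox
    have : E y = 0 := by
      simp only [hE]
      rw [Finset.prod_eq_zero (Finset.mem_univ i), mul_zero]
      exact indicator_of_notMem hi _
    rw [this]
    refine indicator_nonneg (fun y hy => ?_) _
    exact mul_nonneg (dirichletDensity_nonneg hα ((coordMap_mem_simplex_iff y).2 hy).1)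
      (indicator_nonneg (fun _ _ => (Real.exp_pos _).le) _)
  have habs : ∀ i : Fin k, |y i - θs i.castSucc| ≤ η / √t := fun i => by
    have := hbox i
    unfold box at this
    split_ifs at this with h
    · rw [h, sub_zero, abs_of_pos this.1]; exact this.2.trans hηt
    · rw [abs_le]; constructor <;> linarith [this.1, this.2]
  have habs' : ∀ i, |coordMap y i - θs i| ≤ (k + 1) * (η / √t) := fun i => by
    induction i using Fin.lastCases with
    | cast i => rw [coordMap_castSucc]; nlinarith [habs i, (Nat.cast_nonneg k : (0 : ℝ) ≤ k)]
    | last =>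
      have h1 : coordMap y (Fin.last k) - θs (Fin.last k) =
          -∑ i : Fin k, (y i - θs i.castSucc) := by
        have := hθs.2
        rw [Fin.sum_univ_castSucc] at this
        rw [coordMap_last, Finset.sum_sub_distrib]
        linarith
      rw [h1, abs_neg]
      calc _ ≤ ∑ i : Fin k, |y i - θs i.castSucc| := Finset.abs_sum_le_sum_abs _ _
        _ ≤ ∑ i : Fin k, η / √t := Finset.sum_le_sum fun i _ => habs i
        _ ≤ _ := by simp; nlinarith
  have habsη : ∀ i, |coordMap y i - θs i| ≤ (k + 1) * η := fun i =>
    (habs' i).trans (by gcongr)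
  have hhalf : ∀ i, 0 < θs i → θs i / 2 ≤ coordMap y i := fun i hi => by
    have := hrθ i hi
    have := (abs_le.1 (habsη i)).1
    linarith
  have hpos : ∀ i, 0 < coordMap y i := fun i => by
    by_cases hi : 0 < θs i
    · exact (half_pos hi).trans_le (hhalf i hi)
    · have hi0 : θs i = 0 := le_antisymm (not_lt.1 hi) (hθs.1 i)
      induction i using Fin.lastCases with
      | last => exact absurd hlast hi
      | cast i =>
        have := hbox i
        rw [box, if_pos hi0] at this
        rw [coordMap_castSucc]; exact this.1
  have hs : coordMap y ∈ simplex k := ⟨fun i => (hpos i).le, sum_coordMap y⟩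
  have hball : coordMap y ∈ Metric.ball θs δ := by
    rw [Metric.mem_ball, dist_pi_lt_iff hδ]
    exact fun i => (habsη i).trans_lt hηδ
  have hgap : t * gap θs (coordMap y) ≤ C₀ := by
    have h1 : ∑ i, (if θs i = 0 then coordMap y i else 0) ≤ ∑ _i : Fin (k + 1), η / t := by
      refine Finset.sum_le_sum fun i _ => ?_
      split_ifs with h
      · induction i using Fin.lastCases with
        | last => exact absurd h hlast.ne'
        | cast i =>
          have := hbox i
          rw [box, if_pos h] at this
          rw [coordMap_castSucc]; exact this.2
      · positivity
    have h2 : ∑ i, (coordMap y i - θs i) ^ 2 ≤ ∑ _i : Fin (k + 1), ((k + 1) * (η / √t)) ^ 2 := by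
      refine Finset.sum_le_sum fun i _ => ?_
      rw [← sq_abs]
      gcongr
      exact habs' i
    simp only [Finset.sum_const, Finset.card_univ, Fintype.card_fin, nsmul_eq_mul,
      Nat.cast_add, Nat.cast_one] at h1 h2
    calc t * gap θs (coordMap y)
        ≤ t * ((k + 1) * (η / t) + (k + 1) * ((k + 1) * (η / √t)) ^ 2) := by
          gcongr; exact add_le_add h1 h2
      _ = C₀ := by
          rw [mul_pow _ (η / √t), div_pow, hst2, hC₀]
          field_simp
  rw [indicator_of_mem ((coordMap_mem_simplex_iff y).1 hs), indicator_of_mem hball]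
  have hker : ∏ i : Fin k, boxKernel (α i.castSucc) (θs i.castSucc) η t (y i) =
      ∏ i : Fin k, (if θs i.castSucc = 0 then coordMap y i.castSucc ^ (α i.castSucc - 1) else 1) := by
    refine Finset.prod_congr rfl fun i _ => ?_
    rw [boxKernel, indicator_of_mem (hbox i), coordMap_castSucc]
  simp only [hE, hker]
  calc _ = M⁻¹ * (∏ i : Fin k, (if θs i.castSucc = 0 then
            coordMap y i.castSucc ^ (α i.castSucc - 1) else 1)) * Real.exp (-C₀) := by ring
    _ ≤ _ := by
      refine mul_le_mul (hdens _ hs (fun i hi => hhalf i (lt_of_le_of_ne (hθs.1 i) (Ne.symm hi)))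
        hθs.1).1 (Real.exp_le_exp.2 (by linarith)) (Real.exp_pos _).le
        (dirichletDensity_nonneg hα hs.1)

/-! ### Comparison of `H` with the gap function. -/

/-- Second order Taylor expansion with Peano remainder in a normed space. -/
theorem taylor_two_isLittleO {E : Type*} [NormedAddCommGroup E] [NormedSpace ℝ E] {f : E → ℝ}
    {x : E} (hf : ContDiffAt ℝ 2 f x) :
    (fun v => f (x + v) - f x - fderiv ℝ f x v - 1 / 2 * fderiv ℝ (fderiv ℝ f) x v v)
      =o[𝓝 0] fun v => ‖v‖ ^ 2 := by
  set L := fderiv ℝ f x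
  set Q := fderiv ℝ (fderiv ℝ f) x
  have hsymm : ∀ v w, Q v w = Q w v := (hf.isSymmSndFDerivAt (by simp)).eq
  have hdiff : ∀ᶠ y in 𝓝 x, DifferentiableAt ℝ f y :=
    (hf.eventually (by simp)).mono fun y hy => hy.differentiableAt (by simp)
  have hQ : HasFDerivAt (fderiv ℝ f) Q x :=
    ((hf.fderiv_right (m := 1) (by norm_num)).differentiableAt (by simp)).hasFDerivAt
  have hadd : Tendsto (fun v => x + v) (𝓝 0) (𝓝 x) :=
    Continuous.tendsto' (by fun_prop) _ _ (by simp)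
  have hQo := hasFDerivAt_iff_isLittleO_nhds_zero.1 hQ
  rw [isLittleO_iff] at hQo ⊢
  intro ε hε
  obtain ⟨r, hr, hball⟩ := Metric.eventually_nhds_iff_ball.1
    ((hQo hε).and (hadd.eventually hdiff))
  filter_upwards [Metric.ball_mem_nhds 0 hr] with v hv
  rw [mem_ball_zero_iff] at hv
  set g : E → ℝ := fun w => f (x + w) - f x - L w - 1 / 2 * Q w w with hg
  have hderiv : ∀ w ∈ Metric.closedBall (0 : E) ‖v‖,
      HasFDerivWithinAt g (fderiv ℝ f (x + w) - fderiv ℝ f x - Q w)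
        (Metric.closedBall 0 ‖v‖) w := by
    intro w hw
    rw [mem_closedBall_zero_iff] at hw
    have h1 : HasFDerivAt (fun w => f (x + w)) (fderiv ℝ f (x + w)) w := by
      have := (hball w (by simpa using hw.trans_lt hv)).2.hasFDerivAt
      exact this.comp w ((hasFDerivAt_id w).const_add x)
    have h2 : HasFDerivAt (fun w => Q w w) ((Q w).comp (.id ℝ E) + Q.flip w) w := by
      simpa using! Q.hasFDerivAt.clm_apply (hasFDerivAt_id w)
    have h3 := ((h1.sub_const (f x)).sub L.hasFDerivAt).sub (h2.const_mul (1 / 2))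
    refine (h3.congr_fderiv ?_).hasFDerivWithinAt
    ext u
    simp only [sub_apply, smul_apply, smul_eq_mul,
      add_apply, ContinuousLinearMap.flip_apply,
      ContinuousLinearMap.comp_id, hsymm u w]
    ring
  -- The remainder `g` vanishes at `0` and its derivative is at most `ε * ‖v‖` on the ball of radius
  -- `‖v‖`, so the mean value inequality gives `ε * ‖v‖ ^ 2`.
  have := (convex_closedBall (0 : E) ‖v‖).norm_image_sub_le_of_norm_hasFDerivWithin_le
    (C := ε * ‖v‖) hderiv (fun w hw => ?_) (x := 0) (y := v) (by simp) (by simp)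
  · simpa [hg, pow_two, mul_assoc] using this
  · rw [mem_closedBall_zero_iff] at hw
    exact (hball w (by simpa using hw.trans_lt hv)).1.trans (by gcongr)

/-- A quadratic form negative on the part of a linear space where some coordinates vanish becomes
negative on the whole space after subtracting a multiple of the squares of these coordinates. -/
theorem exists_quadratic_le {ι : Type*} [Fintype ι] (Q : (ι → ℝ) →L[ℝ] (ι → ℝ) →L[ℝ] ℝ)
    (z : ι → Prop) [DecidablePred z]
    (hQ : ∀ d : ι → ℝ, d ≠ 0 → ∑ i, d i = 0 → (∀ i, z i → d i = 0) → Q d d < 0) :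
    ∃ c > 0, ∃ C ≥ 0, ∀ d : ι → ℝ, ∑ i, d i = 0 →
      Q d d ≤ -c * ‖d‖ ^ 2 + C * ∑ i, (if z i then d i ^ 2 else 0) := by
  set p : (ι → ℝ) → ℝ := fun d => ∑ i, (if z i then d i ^ 2 else 0) with hp
  have hpc : Continuous p := by
    refine continuous_finsetSum _ fun i _ => ?_
    split_ifs <;> fun_prop
  have hp0 : ∀ d, 0 ≤ p d := fun d => Finset.sum_nonneg fun i _ => by split_ifs <;> positivity
  have hqc : Continuous fun d => Q d d := by fun_prop
  set S : Set (ι → ℝ) := Metric.sphere 0 1 ∩ {d | ∑ i, d i = 0}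
  have hS : IsCompact S :=
    (isCompact_sphere _ _).inter_right (isClosed_eq (by fun_prop) continuous_const)
  have hT : IsCompact (S ∩ {d | 0 ≤ Q d d}) :=
    hS.inter_right (isClosed_le continuous_const hqc)
  -- On the part of the unit sphere where `Q d d ≥ 0`, `p` cannot vanish by `hQ`, so compactness
  -- bounds it below by `p₀ > 0`.
  obtain ⟨p₀, hp₀, hpT⟩ := hT.exists_forall_le' (f := p) (a := 0) hpc.continuousOn (by
    rintro d ⟨⟨hd1, hd2⟩, hd3⟩
    refine lt_of_le_of_ne (hp0 d) fun h => ?_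
    have hz := (Finset.sum_eq_zero_iff_of_nonneg
      (fun i _ => by split_ifs <;> positivity)).1 h.symm
    refine absurd (hQ d ?_ hd2 fun i hi => ?_) (not_lt.2 hd3)
    · rintro rfl; simp at hd1
    · simpa [hi] using hz i (Finset.mem_univ i))
  -- With this value `C * p d` exceeds `Q d d` by at least `1` where `Q d d ≥ 0`; where `Q d d < 0`
  -- the difference is already positive. Homogeneity then extends the bound from the sphere.
  set C := (‖Q‖ + 1) / p₀
  have hC : 0 ≤ C := by positivity
  obtain ⟨c, hc, hcS⟩ := hS.exists_forall_le' (f := fun d => C * p d - Q d d) (a := 0)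
    (by fun_prop) (by
      intro d hd
      by_cases h : 0 ≤ Q d d
      · have h1 := hpT d ⟨hd, h⟩
        have h2 : Q d d ≤ ‖Q‖ := by
          have := Q.le_opNorm₂ d d
          rw [mem_sphere_zero_iff_norm.1 hd.1, mul_one, mul_one] at this
          exact (le_abs_self _).trans this
        have h3 : ‖Q‖ + 1 ≤ C * p d := by
          calc ‖Q‖ + 1 = C * p₀ := (div_mul_cancel₀ _ hp₀.ne').symm
            _ ≤ _ := by gcongr
        linarith
      · have := mul_nonneg hC (hp0 d)
        linarith)
  refine ⟨c, hc, C, hC, fun d hd => ?_⟩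
  by_cases hd0 : d = 0
  · subst hd0; simp
  have hn : 0 < ‖d‖ := norm_pos_iff.2 hd0
  have hmem : ‖d‖⁻¹ • d ∈ S := by
    refine ⟨by simp [norm_smul, hn.ne'], ?_⟩
    simp [← Finset.mul_sum, hd]
  have h := hcS _ hmem
  have hps : p (‖d‖⁻¹ • d) = (‖d‖ ^ 2)⁻¹ * p d := by
    simp only [hp, Finset.mul_sum]
    refine Finset.sum_congr rfl fun i _ => ?_
    split_ifs <;> simp [mul_pow]
  have hqs : Q (‖d‖⁻¹ • d) (‖d‖⁻¹ • d) = (‖d‖ ^ 2)⁻¹ * Q d d := by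
    simp [pow_two, mul_assoc]
  rw [hps, hqs] at h
  have h' : c * ‖d‖ ^ 2 ≤
      (C * ((‖d‖ ^ 2)⁻¹ * p d) - (‖d‖ ^ 2)⁻¹ * Q d d) * ‖d‖ ^ 2 := by gcongr
  have h'' : (C * ((‖d‖ ^ 2)⁻¹ * p d) - (‖d‖ ^ 2)⁻¹ * Q d d) * ‖d‖ ^ 2 = C * p d - Q d d := by
    field_simp
  linarith

theorem norm_sq_le_sum_sq {ι : Type*} [Fintype ι] (v : ι → ℝ) : ‖v‖ ^ 2 ≤ ∑ i, v i ^ 2 := by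
  have h0 : 0 ≤ ∑ i, v i ^ 2 := Finset.sum_nonneg fun i _ => sq_nonneg _
  refine (Real.le_sqrt (norm_nonneg v) h0).1 ((pi_norm_le_iff_of_nonneg (Real.sqrt_nonneg _)).2
    fun i => ?_)
  rw [Real.norm_eq_abs]
  exact Real.abs_le_sqrt (Finset.single_le_sum (f := fun i => v i ^ 2)
    (fun i _ => sq_nonneg _) (Finset.mem_univ i))

theorem sum_sq_le_card_mul_norm_sq {ι : Type*} [Fintype ι] (v : ι → ℝ) :
    ∑ i, v i ^ 2 ≤ Fintype.card ι * ‖v‖ ^ 2 := by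
  calc ∑ i, v i ^ 2 ≤ ∑ _i : ι, ‖v‖ ^ 2 := Finset.sum_le_sum fun i _ => by
        rw [← sq_abs, ← Real.norm_eq_abs]; gcongr; exact norm_le_pi_norm v i
    _ = _ := by simp

/-- Along the simplex the multiple `μ` of the all-ones vector drops out, so the first-order term is
comparable to minus the sum of the zero coordinates. The Hessian controls the rest: its possible
positive part lives on the zero coordinates, where it is second order and is absorbed by the linear
term. -/
theorem Assumptions.eventually_gap_bounds {H : (Fin (k + 1) → ℝ) → EReal}
    {θs : Fin (k + 1) → ℝ} {m : ℕ} (hH : Assumptions H θs m) :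
    ∃ c > 0, ∃ C > 0, ∀ᶠ θ in 𝓝 θs, θ ∈ simplex k →
      realVersion H θs - C * gap θs θ ≤ realVersion H θ ∧
        realVersion H θ ≤ realVersion H θs - c * gap θs θ := by
  set h := realVersion H
  set L := fderiv ℝ h θs
  set Q := fderiv ℝ (fderiv ℝ h) θs
  obtain ⟨lam, μ, hlam, hL⟩ := hH.strict_compl
  obtain ⟨c, hc, C, hC, hQ⟩ := exists_quadratic_le Q (fun i => θs i = 0)
    fun d hd hs hz => hH.neg_def d hd hs fun i hi => hz i ((hH.zero_iff i).2 hi)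
  obtain ⟨l, hl, hlle⟩ := exists_pos_le_of_pos lam
  set Λ := ∑ i, |lam i| with hΛ
  have hΛ0 : 0 ≤ Λ := Finset.sum_nonneg fun i _ => abs_nonneg _
  have hkpos : (0 : ℝ) < k + 1 := by positivity
  refine ⟨min (l / 2) (c / (4 * (k + 1))), by positivity, Λ + ‖Q‖ + c, by positivity, ?_⟩
  have htaylor := (taylor_two_isLittleO hH.contDiffAt).bound (c := c / 4) (by positivity)
  have hsub : Tendsto (fun θ => θ - θs) (𝓝 θs) (𝓝 0) :=
    Continuous.tendsto' (by fun_prop) _ _ (by simp)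
  -- This makes the correction `C * ∑ v i ^ 2` over zero coordinates at most `l * a`; the Taylor
  -- factor `1/2` then costs only half of the linear decrease `l * a`.
  have hnorm : ∀ᶠ v : Fin (k + 1) → ℝ in 𝓝 0, C * ‖v‖ < l := by
    have : Tendsto (fun v : Fin (k + 1) → ℝ => C * ‖v‖) (𝓝 0) (𝓝 0) :=
      Continuous.tendsto' (by fun_prop) _ _ (by simp)
    exact this.eventually (gt_mem_nhds hl)
  filter_upwards [hsub.eventually htaylor, hsub.eventually hnorm] with θ ht hn hθ
  set v := θ - θs with hv
  rw [add_sub_cancel, Real.norm_eq_abs, Real.norm_of_nonneg (by positivity), abs_le] at ht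
  have hsum : ∑ i, v i = 0 := by simp [hv, hθ.2, hH.mem_simplex.2]
  set a := ∑ i, (if θs i = 0 then θ i else 0) with ha
  have ha0 : 0 ≤ a := Finset.sum_nonneg fun i _ => by split_ifs <;> simp [hθ.1 i]
  have hLv : L v = -∑ i, (if θs i = 0 then lam i * θ i else 0) := by
    conv_lhs => rw [pi_eq_sum_univ' v]
    rw [map_sum]
    have : ∀ i, L (v i • Pi.single i 1) = -(if θs i = 0 then lam i * θ i else 0) + μ * v i := by
      intro i
      rw [map_smul, hL i, smul_eq_mul]
      by_cases hz : θs i = 0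
      · simp [hz, (hH.zero_iff i).1 hz, hv]; ring
      · simp [hz, mt (hH.zero_iff i).2 hz]; ring
    simp only [this, Finset.sum_add_distrib, ← Finset.mul_sum, hsum, Finset.sum_neg_distrib]
    simp
  have hLle : L v ≤ -l * a := by
    rw [hLv, neg_mul, neg_le_neg_iff, ha, Finset.mul_sum]
    refine Finset.sum_le_sum fun i _ => ?_
    split_ifs with hz
    · exact mul_le_mul_of_nonneg_right (hlle i (hlam i ((hH.zero_iff i).1 hz))) (hθ.1 i)
    · simp
  have hleL : -Λ * a ≤ L v := by
    rw [hLv, neg_mul, neg_le_neg_iff, ha, Finset.mul_sum]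
    refine Finset.sum_le_sum fun i _ => ?_
    split_ifs with hz
    · refine mul_le_mul_of_nonneg_right ((le_abs_self _).trans ?_) (hθ.1 i)
      exact Finset.single_le_sum (f := fun i => |lam i|) (fun i _ => abs_nonneg _)
        (Finset.mem_univ i)
    · simp
  have hpv : ∑ i, (if θs i = 0 then v i ^ 2 else 0) ≤ ‖v‖ * a := by
    rw [ha, Finset.mul_sum]
    refine Finset.sum_le_sum fun i _ => ?_
    split_ifs with hz
    · have h1 : v i = θ i := by simp [hv, hz]
      have h2 : v i ≤ ‖v‖ := (le_abs_self _).trans (norm_le_pi_norm v i)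
      rw [pow_two]
      nlinarith [hθ.1 i]
    · simp
  have hQle := hQ v hsum
  have hQge : |Q v v| ≤ ‖Q‖ * ‖v‖ ^ 2 := by
    simpa [pow_two, mul_assoc] using Q.le_opNorm₂ v v
  have hgap : gap θs θ = a + ∑ i, v i ^ 2 := rfl
  have hs1 := norm_sq_le_sum_sq v
  have hs2 := sum_sq_le_card_mul_norm_sq v
  simp only [Fintype.card_fin, Nat.cast_add, Nat.cast_one] at hs2
  have hs0 : 0 ≤ ∑ i, v i ^ 2 := Finset.sum_nonneg fun i _ => sq_nonneg _
  have hn0 := norm_nonneg v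
  have hQ0 := norm_nonneg Q
  constructor
  · have e1 : -(‖Q‖ * ‖v‖ ^ 2) ≤ Q v v := (abs_le.1 hQge).1
    have e2 : Λ * a + (‖Q‖ + c) * ‖v‖ ^ 2 ≤ (Λ + ‖Q‖ + c) * gap θs θ := by
      rw [hgap]
      nlinarith [mul_le_mul_of_nonneg_left hs1 (by positivity : 0 ≤ ‖Q‖ + c),
        mul_nonneg (by positivity : 0 ≤ ‖Q‖ + c) ha0, mul_nonneg hΛ0 hs0]
    nlinarith [mul_nonneg hQ0 (sq_nonneg ‖v‖), mul_nonneg hc.le (sq_nonneg ‖v‖)]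
  · have e1 : C * ∑ i, (if θs i = 0 then v i ^ 2 else 0) ≤ l * a := by
      calc _ ≤ C * (‖v‖ * a) := by gcongr
        _ = (C * ‖v‖) * a := by ring
        _ ≤ _ := by gcongr
    have e2 : min (l / 2) (c / (4 * (k + 1))) * gap θs θ ≤ l / 2 * a + c / 4 * ‖v‖ ^ 2 := by
      rw [hgap, mul_add]
      refine add_le_add (mul_le_mul_of_nonneg_right (min_le_left _ _) ha0) ?_
      calc _ ≤ c / (4 * (k + 1)) * ((k + 1) * ‖v‖ ^ 2) := by
            refine mul_le_mul (min_le_right _ _) hs2 hs0 (by positivity)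
        _ = _ := by field_simp
    linarith [ht.2]

theorem Assumptions.coe_realVersion_self {H : (Fin (k + 1) → ℝ) → EReal}
    {θs : Fin (k + 1) → ℝ} {m : ℕ} (hH : Assumptions H θs m) :
    (realVersion H θs : EReal) = H θs :=
  EReal.coe_toReal (hH.ne_top θs) hH.finite_near.self_of_nhds

/-- Outside a neighborhood of `θs`, `H` stays below some `r < H θs` while the gap is bounded, so a
small enough multiple of the gap fits into the difference. -/
theorem Assumptions.exists_le_sub_gap {H : (Fin (k + 1) → ℝ) → EReal}
    {θs : Fin (k + 1) → ℝ} {m : ℕ} (hH : Assumptions H θs m) :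
    ∃ c > 0, ∀ θ ∈ simplex k, H θ ≤ ((realVersion H θs - c * gap θs θ : ℝ) : EReal) := by
  obtain ⟨c, hc, _, _, hloc⟩ := hH.eventually_gap_bounds
  obtain ⟨U, hU, hUo, hθU⟩ := eventually_nhds_iff.1 (hloc.and hH.finite_near)
  have hK : IsCompact (simplex k \ U) := isCompact_simplex.diff hUo
  obtain ⟨G, hG⟩ := isCompact_simplex.bddAbove_image (continuous_gap θs).continuousOn
  have hG' : ∀ θ ∈ simplex k, gap θs θ ≤ max G 1 := fun θ hθ =>
    (hG (mem_image_of_mem _ hθ)).trans (le_max_left _ _)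
  obtain ⟨r, hr, hrK⟩ : ∃ r < realVersion H θs, ∀ θ ∈ simplex k \ U, H θ ≤ (r : EReal) := by
    rcases (simplex k \ U).eq_empty_or_nonempty with he | hne
    · exact ⟨realVersion H θs - 1, by linarith, by simp [he]⟩
    · obtain ⟨θ₀, hθ₀, hmax⟩ := hK.exists_isMaxOn hne (hH.continuousOn.mono sdiff_subset)
      have hlt := hH.unique_max θ₀ hθ₀.1 (by rintro rfl; exact hθ₀.2 hθU)
      rw [← hH.coe_realVersion_self] at hlt
      -- The maximum over the remaining compact set may be `⊥`, so a real number strictly above it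
      -- is used instead.
      obtain ⟨r, hr1, hr2⟩ := EReal.lt_iff_exists_real_btwn.1 hlt
      exact ⟨r, EReal.coe_lt_coe_iff.1 hr2, fun θ hθ => (hmax hθ).trans hr1.le⟩
  have hG1 : 0 < max G 1 := lt_max_of_lt_right one_pos
  refine ⟨min c ((realVersion H θs - r) / max G 1),
    lt_min hc (div_pos (sub_pos.2 hr) hG1), fun θ hθ => ?_⟩
  have hg0 := gap_nonneg θs hθ
  by_cases hθU' : θ ∈ U
  · obtain ⟨h1, h2⟩ := hU θ hθU'
    rw [← EReal.coe_toReal (hH.ne_top θ) h2, EReal.coe_le_coe_iff]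
    refine (h1 hθ).2.trans ?_
    gcongr
    exact min_le_left _ _
  · refine (hrK θ ⟨hθ, hθU'⟩).trans (EReal.coe_le_coe_iff.2 ?_)
    have : min c ((realVersion H θs - r) / max G 1) * gap θs θ ≤
        (realVersion H θs - r) / max G 1 * max G 1 :=
      mul_le_mul (min_le_right _ _) (hG' θ hθ) hg0 (div_pos (sub_pos.2 hr) hG1).le
    rw [div_mul_cancel₀ _ hG1.ne'] at this
    linarith

theorem Assumptions.exists_sub_gap_le {H : (Fin (k + 1) → ℝ) → EReal}
    {θs : Fin (k + 1) → ℝ} {m : ℕ} (hH : Assumptions H θs m) :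
    ∃ C > 0, ∃ δ > 0, ∀ θ ∈ simplex k, θ ∈ Metric.ball θs δ →
      ((realVersion H θs - C * gap θs θ : ℝ) : EReal) ≤ H θ := by
  obtain ⟨_, _, C, hC, hloc⟩ := hH.eventually_gap_bounds
  obtain ⟨δ, hδ, hball⟩ := Metric.eventually_nhds_iff_ball.1 (hloc.and hH.finite_near)
  refine ⟨C, hC, δ, hδ, fun θ hθ hθδ => ?_⟩
  obtain ⟨h1, h2⟩ := hball θ hθδ
  rw [← EReal.coe_toReal (hH.ne_top θ) h2, EReal.coe_le_coe_iff]
  exact (h1 hθ).1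

/-! ### Comparison of the Kullback-Leibler divergence with the gap function. -/

/-- The Kullback-Leibler divergence of the weight vectors `θs` and `θ`. -/
noncomputable def klGap (θs θ : Fin (k + 1) → ℝ) : ℝ :=
  ∑ i, θs i * (Real.log (θs i) - Real.log (θ i))

theorem measurable_klGap (θs : Fin (k + 1) → ℝ) : Measurable (klGap θs) := by
  unfold klGap
  fun_prop

theorem prod_rpow_eq_exp_klGap (θs : Fin (k + 1) → ℝ) {θ : Fin (k + 1) → ℝ} (hθ : ∀ i, 0 < θ i)
    (s : ℝ) :
    ∏ i, θ i ^ (s * θs i) =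
      Real.exp (s * ∑ i, θs i * Real.log (θs i)) * Real.exp (-s * klGap θs θ) := by
  rw [← Real.exp_add, klGap, Finset.mul_sum, Finset.mul_sum, ← Finset.sum_add_distrib,
    Real.exp_sum]
  refine Finset.prod_congr rfl fun i _ => ?_
  rw [Real.rpow_def_of_pos (hθ i)]
  congr 1
  ring

/-- Applying `log u ≤ u - 1` to `u = √x / √s` instead of `x / s` gains a square: with `s = q ^ 2`,
`x = p ^ 2` the right side is at least `2 * q * (q - p) = s - x + (q - p) ^ 2`, and `(q - p) ^ 2 ≥
(s - x) ^ 2 / 4` since `p + q ≤ 2`. -/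
theorem le_mul_log_sub_log {s x : ℝ} (hs : 0 < s) (hs1 : s ≤ 1) (hx : 0 < x) (hx1 : x ≤ 1) :
    s - x + (x - s) ^ 2 / 4 ≤ s * (Real.log s - Real.log x) := by
  obtain ⟨q, hq, rfl⟩ : ∃ q > 0, q ^ 2 = s := ⟨√s, Real.sqrt_pos.2 hs, Real.sq_sqrt hs.le⟩
  obtain ⟨p, hp, rfl⟩ : ∃ p > 0, p ^ 2 = x := ⟨√x, Real.sqrt_pos.2 hx, Real.sq_sqrt hx.le⟩
  have h := Real.log_le_sub_one_of_pos (div_pos hp hq)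
  rw [Real.log_div hp.ne' hq.ne'] at h
  have h1 : q ^ 2 * (Real.log p - Real.log q) ≤ q ^ 2 * (p / q - 1) := by gcongr
  have h2 : q ^ 2 * (p / q - 1) = q * (p - q) := by field_simp
  rw [Real.log_pow, Real.log_pow]
  push_cast
  have hp1 : p ≤ 1 := by nlinarith
  have hq1 : q ≤ 1 := by nlinarith
  have h3 : (p + q) ^ 2 ≤ 4 := by nlinarith
  have h4 : (p ^ 2 - q ^ 2) ^ 2 = (p - q) ^ 2 * (p + q) ^ 2 := by ring
  nlinarith [mul_le_mul_of_nonneg_left h3 (sq_nonneg (p - q))]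

theorem mul_log_sub_log_le {s x ε : ℝ} (hs : 0 < s) (hε : 0 < ε) (hx : ε ≤ x) :
    s * (Real.log s - Real.log x) ≤ s - x + (x - s) ^ 2 / ε := by
  have hx0 := hε.trans_le hx
  have h := Real.log_le_sub_one_of_pos (div_pos hs hx0)
  rw [Real.log_div hs.ne' hx0.ne'] at h
  calc _ ≤ s * (s / x - 1) := by gcongr
    _ = s - x + (x - s) ^ 2 / x := by field_simp; ring
    _ ≤ _ := by gcongr

/-- The first-order terms `θs i - θ i` sum to zero, so they can be added freely. At a zero
coordinate this supplies the missing linear term, and `θ i ≤ 1` controls the square. -/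
theorem gap_le_klGap {θs θ : Fin (k + 1) → ℝ} (hθs : θs ∈ simplex k) (hθ : θ ∈ simplex k)
    (hpos : ∀ i, 0 < θ i) : 1 / 4 * gap θs θ ≤ klGap θs θ := by
  have h0 : ∑ i, (θs i - θ i) = 0 := by rw [Finset.sum_sub_distrib, hθs.2, hθ.2, sub_self]
  have h : ∑ i, (θs i - θ i) + 1 / 4 * gap θs θ ≤ klGap θs θ := by
    rw [gap, klGap, ← Finset.sum_add_distrib, Finset.mul_sum, ← Finset.sum_add_distrib]
    refine Finset.sum_le_sum fun i _ => ?_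
    have h1 := le_one_of_mem_simplex hθ i
    split_ifs with hz
    · rw [hz]
      nlinarith [hpos i]
    · have := le_mul_log_sub_log (lt_of_le_of_ne (hθs.1 i) (Ne.symm hz))
        (le_one_of_mem_simplex hθs i) (hpos i) h1
      linarith
  linarith

/-- The truncation enters here: without `ε ≤ θ i` the logarithm is unbounded near the faces where
`θs i > 0`. -/
theorem klGap_le_gap {θs θ : Fin (k + 1) → ℝ} (hθs : θs ∈ simplex k) {ε : ℝ} (hε : 0 < ε)
    (hθ : θ ∈ truncSimplex θs ε) : klGap θs θ ≤ max 1 ε⁻¹ * gap θs θ := by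
  have h0 : ∑ i, (θs i - θ i) = 0 := by rw [Finset.sum_sub_distrib, hθs.2, hθ.1.2, sub_self]
  have h : klGap θs θ ≤ ∑ i, (θs i - θ i) + max 1 ε⁻¹ * gap θs θ := by
    rw [gap, klGap, ← Finset.sum_add_distrib, Finset.mul_sum, ← Finset.sum_add_distrib]
    refine Finset.sum_le_sum fun i _ => ?_
    have h1 : θ i ≤ max 1 ε⁻¹ * θ i := le_mul_of_one_le_left (hθ.1.1 i) (le_max_left _ _)
    have h2 : (θ i - θs i) ^ 2 / ε ≤ max 1 ε⁻¹ * (θ i - θs i) ^ 2 := by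
      rw [div_eq_mul_inv, mul_comm]; gcongr; exact le_max_right _ _
    split_ifs with hz
    · rw [mul_add, hz]
      have : 0 ≤ max 1 ε⁻¹ * (θ i - 0) ^ 2 := by positivity
      linarith
    · have hpos := lt_of_le_of_ne (hθs.1 i) (Ne.symm hz)
      have := mul_log_sub_log_le hpos hε (hθ.2 i hpos)
      linarith
  linarith

/-! ### From gap bounds to orders of magnitude, and moments of the estimators. -/

/-- Laplace asymptotics, up to constants, for integrands squeezed between exponentials of the
gap function. -/
theorem isTheta_integral_of_gap_bounds {α θs : Fin (k + 1) → ℝ} (hα : ∀ i, 0 < α i)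
    [IsProbabilityMeasure (dirichlet α)] (hθs : θs ∈ simplex k) (hlast : 0 < θs (Fin.last k))
    {F : ℝ → (Fin (k + 1) → ℝ) → ℝ} {c C δ : ℝ} (hc : 0 < c) (hC : 0 < C) (hδ : 0 < δ)
    (hmeas : ∀ᶠ t in atTop, AEStronglyMeasurable (F t) (dirichlet α))
    (hupper : ∀ᶠ t in atTop, ∀ θ ∈ simplex k, (∀ i, 0 < θ i) →
      0 ≤ F t θ ∧ F t θ ≤ Real.exp (-(c * t) * gap θs θ))
    (hlower : ∀ᶠ t in atTop, ∀ θ ∈ simplex k, (∀ i, 0 < θ i) → θ ∈ Metric.ball θs δ →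
      Real.exp (-(C * t) * gap θs θ) ≤ F t θ) :
    (fun t => ∫ θ, F t θ ∂dirichlet α) =Θ[atTop] fun t : ℝ => t ^ (-decayRate α θs) := by
  obtain ⟨C₁, hC₁, h₁⟩ := exists_integral_exp_neg_gap_le hα hθs.1 hlast
  obtain ⟨C₂, hC₂, h₂⟩ := exists_le_setIntegral_exp_neg_gap hα hθs hlast hδ
  replace h₁ := (tendsto_id.const_mul_atTop hc).eventually h₁
  replace h₂ := (tendsto_id.const_mul_atTop hC).eventually h₂
  simp only [id] at h₁ h₂
  have hae := (ae_mem_simplex α).and (ae_pos α)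
  constructor
  · refine IsBigO.of_bound (C₁ * c ^ (-decayRate α θs)) ?_
    filter_upwards [h₁, hupper, eventually_gt_atTop 0] with t h1 hup ht
    rw [Real.norm_of_nonneg (integral_nonneg_of_ae (hae.mono fun θ h => (hup θ h.1 h.2).1)),
      Real.norm_of_nonneg (Real.rpow_nonneg ht.le _)]
    calc _ ≤ ∫ θ, Real.exp (-(c * t) * gap θs θ) ∂dirichlet α :=
          integral_mono_of_nonneg (hae.mono fun θ h => (hup θ h.1 h.2).1)
            (integrable_exp_neg_gap α θs (by positivity)) (hae.mono fun θ h => (hup θ h.1 h.2).2)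
      _ ≤ _ := by rw [Real.mul_rpow hc.le ht.le] at h1; linarith
  · refine IsBigO.of_bound (C₂ * C ^ (-decayRate α θs))⁻¹ ?_
    filter_upwards [h₂, hmeas, hupper, hlower, eventually_gt_atTop 0] with t h2 hm hup hlo ht
    rw [Real.norm_of_nonneg (integral_nonneg_of_ae (hae.mono fun θ h => (hup θ h.1 h.2).1)),
      Real.norm_of_nonneg (Real.rpow_nonneg ht.le _), le_inv_mul_iff₀ (by positivity)]
    rw [Real.mul_rpow hC.le ht.le, ← mul_assoc] at h2
    have hFint : Integrable (F t) (dirichlet α) := by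
      refine (integrable_exp_neg_gap α θs (t := c * t) (by positivity)).mono hm
        (hae.mono fun θ h => ?_)
      rw [Real.norm_of_nonneg (hup θ h.1 h.2).1, Real.norm_of_nonneg (Real.exp_pos _).le]
      exact (hup θ h.1 h.2).2
    calc _ ≤ _ := h2
      _ ≤ ∫ θ in Metric.ball θs δ, F t θ ∂dirichlet α := by
          refine setIntegral_mono_on_ae
            (integrable_exp_neg_gap α θs (by positivity)).integrableOn hFint.integrableOn
            Metric.isOpen_ball.measurableSet (hae.mono fun θ h hb => hlo θ h.1 h.2 hb)
      _ ≤ _ := setIntegral_le_integral hFint (hae.mono fun θ h => (hup θ h.1 h.2).1)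

theorem expScaled_nonneg (n : ℝ) (h : EReal) : 0 ≤ expScaled n h := ENNReal.toReal_nonneg

theorem expScaled_coe (n x : ℝ) : expScaled n (x : EReal) = Real.exp (n * x) := by
  rw [expScaled, ← EReal.coe_mul, EReal.exp_coe, ENNReal.toReal_ofReal (Real.exp_pos _).le]

theorem expScaled_bot {n : ℝ} (hn : 0 < n) : expScaled n ⊥ = 0 := by
  rw [expScaled, EReal.coe_mul_bot_of_pos hn]; simp

theorem expScaled_le {n r : ℝ} {h : EReal} (hn : 0 < n) (hr : h ≤ (r : EReal)) :
    expScaled n h ≤ Real.exp (n * r) := by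
  induction h with
  | bot => rw [expScaled_bot hn]; exact (Real.exp_pos _).le
  | coe x =>
    rw [expScaled_coe]
    have := EReal.coe_le_coe_iff.1 hr
    gcongr
  | top => simp at hr

theorem le_expScaled {n r : ℝ} {h : EReal} (hn : 0 < n) (hr : (r : EReal) ≤ h) (htop : h ≠ ⊤) :
    Real.exp (n * r) ≤ expScaled n h := by
  induction h with
  | bot => simp at hr
  | coe x =>
    rw [expScaled_coe]
    have := EReal.coe_le_coe_iff.1 hr
    gcongr
  | top => exact absurd rfl htop

theorem expScaled_sq {n : ℝ} {h : EReal} (hn : 0 < n) (htop : h ≠ ⊤) :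
    expScaled n h ^ 2 = expScaled (2 * n) h := by
  induction h with
  | bot => rw [expScaled_bot hn, expScaled_bot (by positivity)]; simp
  | coe x => rw [expScaled_coe, expScaled_coe, ← Real.exp_nat_mul]; push_cast; ring_nf
  | top => exact absurd rfl htop

theorem measurable_expScaled (n : ℝ) : Measurable (expScaled n) := by
  unfold expScaled
  exact (EReal.measurable_exp.comp (measurable_const.mul measurable_id)).ennreal_toReal

theorem Assumptions.aemeasurable_expScaled {H : (Fin (k + 1) → ℝ) → EReal}
    {θs : Fin (k + 1) → ℝ} {m : ℕ} (hH : Assumptions H θs m) (n : ℝ) (β : Fin (k + 1) → ℝ) :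
    AEMeasurable (fun θ => expScaled n (H θ)) (dirichlet β) := by
  refine (measurable_expScaled n).comp_aemeasurable ?_
  rw [← Measure.restrict_eq_self_of_ae_mem (ae_mem_simplex β)]
  exact hH.continuousOn.aemeasurable isClosed_simplex.measurableSet

theorem isClosed_truncSimplex (θs : Fin (k + 1) → ℝ) (ε : ℝ) : IsClosed (truncSimplex θs ε) := by
  simp only [truncSimplex, ofPred_and, ofPred_forall]
  exact isClosed_simplex.inter (isClosed_iInter fun i => isClosed_iInter fun _ =>
    isClosed_le continuous_const (continuous_apply i))

/-- The law of a random vector has mass one, so the normalisation of the Dirichlet density comes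
from the existence of a sample, and the Beta integral need not be evaluated. -/
theorem IsIIDSample.isProbabilityMeasure {Ω : Type*} [MeasurableSpace Ω] {N : ℕ} (hN : 1 ≤ N)
    {X : Fin N → Ω → Fin (k + 1) → ℝ} {ν : Measure (Fin (k + 1) → ℝ)} {P : Measure Ω}
    [IsProbabilityMeasure P] (hX : IsIIDSample X ν P) : IsProbabilityMeasure ν :=
  (hX.1 ⟨0, hN⟩).isProbabilityMeasure_iff.1 inferInstance

/-- The variance of the sample mean of a square integrable function of an i.i.d. sample. -/
theorem IsIIDSample.variance_mean {Ω : Type*} [MeasurableSpace Ω] {N : ℕ} (hN : 1 ≤ N)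
    {X : Fin N → Ω → Fin (k + 1) → ℝ} {ν : Measure (Fin (k + 1) → ℝ)} {P : Measure Ω}
    [IsProbabilityMeasure P] (hX : IsIIDSample X ν P) {g : (Fin (k + 1) → ℝ) → ℝ}
    (hg : MemLp g 2 ν) :
    variance (fun ω => 1 / (N : ℝ) * ∑ i, g (X i ω)) P =
      1 / (N : ℝ) * (∫ θ, g θ ^ 2 ∂ν - (∫ θ, g θ ∂ν) ^ 2) := by
  have hlaw := hX.1
  have hmem : ∀ i, MemLp (g ∘ X i) 2 P := fun i =>
    MemLp.comp_of_map (by rwa [(hlaw i).map_eq]) (hlaw i).aemeasurable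
  have hvar : ∀ i, variance (g ∘ X i) P = ∫ θ, g θ ^ 2 ∂ν - (∫ θ, g θ ∂ν) ^ 2 := fun i => by
    rw [variance_eq_sub (hmem i), (hlaw i).integral_comp hg.aestronglyMeasurable]
    congr 1
    exact (hlaw i).integral_comp (f := fun θ => g θ ^ 2) (hg.aestronglyMeasurable.pow 2)
  have hindep : iIndepFun (fun i => g ∘ X i) P :=
    hX.2.comp₀ (fun _ => g) (fun i => (hlaw i).aemeasurable) fun i => by
      rw [(hlaw i).map_eq]; exact hg.aestronglyMeasurable.aemeasurable
  have hsum := IndepFun.variance_sum (s := Finset.univ) (fun i _ => hmem i)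
    fun i _ j _ hij => hindep.indepFun hij
  have hfun : (fun ω => ∑ i, g (X i ω)) = ∑ i, g ∘ X i := by ext ω; simp
  have hN0 : (N : ℝ) ≠ 0 := by positivity
  rw [variance_const_mul, hfun, hsum, Finset.sum_congr rfl fun i _ => hvar i]
  simp only [Finset.sum_const, Finset.card_univ, Fintype.card_fin, nsmul_eq_mul]
  field_simp

/-! ### The proposal as an exponential tilt of the prior. -/

section Proposal

variable {α θs : Fin (k + 1) → ℝ} {s : ℝ}

/-- The normalisation of the Dirichlet distribution with parameter `α + s • θs` expresses a ratio
of Beta functions as a Laplace integral of the Kullback-Leibler divergence. -/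
theorem multiBeta_div_mul_exp (hα : ∀ i, 0 < α i) (hθs : ∀ i, 0 ≤ θs i) (hs : 0 ≤ s)
    [IsProbabilityMeasure (dirichlet (α + s • θs))] :
    multiBeta α / multiBeta (α + s • θs) * Real.exp (s * ∑ i, θs i * Real.log (θs i)) =
      (∫ θ, Real.exp (-s * klGap θs θ) ∂dirichlet α)⁻¹ := by
  have h := integral_dirichlet_add hα (s := s • θs) (fun i => mul_nonneg hs (hθs i)) (fun _ => 1)
  have h2 : ∫ θ, (∏ i, θ i ^ (s • θs) i) * 1 ∂dirichlet α =
      Real.exp (s * ∑ i, θs i * Real.log (θs i)) *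
        ∫ θ, Real.exp (-s * klGap θs θ) ∂dirichlet α := by
    rw [← integral_const_mul]
    refine integral_congr_ae ?_
    filter_upwards [ae_pos α] with θ hθ
    simpa using prod_rpow_eq_exp_klGap θs hθ s
  rw [h2] at h
  simp only [integral_const, probReal_univ, smul_eq_mul, mul_one] at h
  refine eq_inv_of_mul_eq_one_left ?_
  rw [mul_assoc]
  exact h.symm

theorem integral_exp_klGap_pos (hα : ∀ i, 0 < α i) (hθs : ∀ i, 0 ≤ θs i) (hs : 0 ≤ s)
    [IsProbabilityMeasure (dirichlet (α + s • θs))] :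
    0 < ∫ θ, Real.exp (-s * klGap θs θ) ∂dirichlet α := by
  rw [← inv_pos, ← multiBeta_div_mul_exp hα hθs hs]
  have h1 := multiBeta_pos hα
  have h2 := multiBeta_pos (α := α + s • θs) fun i =>
    add_pos_of_pos_of_nonneg (hα i) (mul_nonneg hs (hθs i))
  positivity

theorem integral_dirichlet_add_smul (hα : ∀ i, 0 < α i) (hθs : ∀ i, 0 ≤ θs i) (hs : 0 ≤ s)
    [IsProbabilityMeasure (dirichlet (α + s • θs))] (f : (Fin (k + 1) → ℝ) → ℝ) :
    ∫ θ, f θ ∂dirichlet (α + s • θs) = (∫ θ, Real.exp (-s * klGap θs θ) ∂dirichlet α)⁻¹ *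
      ∫ θ, Real.exp (-s * klGap θs θ) * f θ ∂dirichlet α := by
  rw [integral_dirichlet_add hα (s := s • θs) (fun i => mul_nonneg hs (hθs i)),
    ← multiBeta_div_mul_exp hα hθs hs, mul_assoc, ← integral_const_mul (Real.exp _)]
  congr 1
  refine integral_congr_ae ?_
  filter_upwards [ae_pos α] with θ hθ
  rw [← mul_assoc, ← prod_rpow_eq_exp_klGap θs hθ s]
  rfl

theorem dirichletDensity_div (hα : ∀ i, 0 < α i) (hθs : ∀ i, 0 ≤ θs i) (hs : 0 ≤ s)
    [IsProbabilityMeasure (dirichlet (α + s • θs))] {θ : Fin (k + 1) → ℝ} (hθ : ∀ i, 0 < θ i) :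
    dirichletDensity α θ / dirichletDensity (α + s • θs) θ =
      (∫ θ, Real.exp (-s * klGap θs θ) ∂dirichlet α) * Real.exp (s * klGap θs θ) := by
  have hpos : 0 < dirichletDensity α θ :=
    mul_pos (one_div_pos.2 (multiBeta_pos hα))
      (Finset.prod_pos fun i _ => Real.rpow_pos_of_pos (hθ i) _)
  have hW : ∏ i, θ i ^ (s • θs) i = _ := prod_rpow_eq_exp_klGap θs hθ s
  rw [dirichletDensity_add hα hθ, hW, ← mul_assoc, multiBeta_div_mul_exp hα hθs hs, neg_mul,
    Real.exp_neg]
  have := (integral_exp_klGap_pos hα hθs hs).ne'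
  field_simp

end Proposal

/-- The summand of the truncated importance sampling estimator. -/
noncomputable def isWeight (H : (Fin (k + 1) → ℝ) → EReal) (α θs : Fin (k + 1) → ℝ)
    (ε n s : ℝ) (θ : Fin (k + 1) → ℝ) : ℝ :=
  expScaled n (H θ) * (dirichletDensity α θ / dirichletDensity (α + s • θs) θ) *
    (truncSimplex θs ε).indicator 1 θ

section Moments

variable {H : (Fin (k + 1) → ℝ) → EReal} {α θs : Fin (k + 1) → ℝ} {m : ℕ} {ε n s : ℝ}

theorem indicator_one_sq {X : Type*} (S : Set X) (x : X) :
    (S.indicator (1 : X → ℝ) x) ^ 2 = S.indicator 1 x := by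
  by_cases h : x ∈ S <;> simp [h]

/-- The weight exactly undoes the tilt, so the only bias is that of the truncation. -/
theorem integral_isWeight (hα : ∀ i, 0 < α i) (hθs : ∀ i, 0 ≤ θs i) (hs : 0 ≤ s)
    [IsProbabilityMeasure (dirichlet (α + s • θs))] :
    ∫ θ, isWeight H α θs ε n s θ ∂dirichlet (α + s • θs) =
      ∫ θ, expScaled n (H θ) * (truncSimplex θs ε).indicator 1 θ ∂dirichlet α := by
  have hZ := (integral_exp_klGap_pos hα hθs hs).ne'
  rw [integral_dirichlet_add_smul hα hθs hs, ← integral_const_mul]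
  refine integral_congr_ae ?_
  filter_upwards [ae_pos α] with θ hθ
  rw [isWeight, dirichletDensity_div hα hθs hs hθ, neg_mul, Real.exp_neg]
  generalize ∫ θ, Real.exp (-s * klGap θs θ) ∂dirichlet α = Z at hZ ⊢
  field_simp

/-- One of the two weights undoes the tilt; the other survives as `Z * exp (s * klGap)`. -/
theorem integral_isWeight_sq (hα : ∀ i, 0 < α i) (hθs : ∀ i, 0 ≤ θs i) (hs : 0 ≤ s)
    (hn : 0 < n) (hH : ∀ θ, H θ ≠ ⊤) [IsProbabilityMeasure (dirichlet (α + s • θs))] :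
    ∫ θ, isWeight H α θs ε n s θ ^ 2 ∂dirichlet (α + s • θs) =
      (∫ θ, Real.exp (-s * klGap θs θ) ∂dirichlet α) *
        ∫ θ, expScaled (2 * n) (H θ) * Real.exp (s * klGap θs θ) *
          (truncSimplex θs ε).indicator 1 θ ∂dirichlet α := by
  have hZ := (integral_exp_klGap_pos hα hθs hs).ne'
  rw [integral_dirichlet_add_smul hα hθs hs, ← integral_const_mul, ← integral_const_mul]
  refine integral_congr_ae ?_
  filter_upwards [ae_pos α] with θ hθ
  rw [isWeight, dirichletDensity_div hα hθs hs hθ, mul_pow, mul_pow, expScaled_sq hn (hH θ),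
    indicator_one_sq, neg_mul, Real.exp_neg]
  generalize ∫ θ, Real.exp (-s * klGap θs θ) ∂dirichlet α = Z at hZ ⊢
  field_simp

/-- On the truncated simplex the divergence is bounded by a multiple of the gap, hence by a
constant, so the summand is bounded. -/
theorem memLp_isWeight (hH : Assumptions H θs m) (hα : ∀ i, 0 < α i) (hs : 0 ≤ s) (hn : 0 < n)
    (hε : 0 < ε) [IsProbabilityMeasure (dirichlet (α + s • θs))] :
    MemLp (isWeight H α θs ε n s) 2 (dirichlet (α + s • θs)) := by
  have hθs := hH.mem_simplex.1
  have hZ := integral_exp_klGap_pos hα hθs hs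
  obtain ⟨G, hG⟩ := isCompact_simplex.bddAbove_image (continuous_gap θs).continuousOn
  obtain ⟨c, hc, hle⟩ := hH.exists_le_sub_gap
  refine MemLp.of_bound (C := Real.exp (n * realVersion H θs) *
    ((∫ θ, Real.exp (-s * klGap θs θ) ∂dirichlet α) * Real.exp (s * (max 1 ε⁻¹ * G))) * 1) ?_ ?_
  · refine AEMeasurable.aestronglyMeasurable (((hH.aemeasurable_expScaled n _).mul
      ((measurable_dirichletDensity _).div (measurable_dirichletDensity _)).aemeasurable).mul ?_)
    exact (measurable_one.indicator (isClosed_truncSimplex θs ε).measurableSet).aemeasurable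
  · filter_upwards [ae_mem_simplex _, ae_pos _] with θ hθ hpos
    have h0 := gap_nonneg θs hθ
    rw [isWeight, dirichletDensity_div hα hθs hs hpos]
    by_cases hT : θ ∈ truncSimplex θs ε
    · rw [indicator_of_mem hT, Pi.one_apply, Real.norm_of_nonneg (by
        have := expScaled_nonneg n (H θ); positivity)]
      have h1 : expScaled n (H θ) ≤ Real.exp (n * realVersion H θs) := by
        refine expScaled_le hn ((hle θ hθ).trans (EReal.coe_le_coe_iff.2 ?_))
        nlinarith
      have h2 : klGap θs θ ≤ max 1 ε⁻¹ * G :=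
        (klGap_le_gap hH.mem_simplex hε hT).trans (by
          gcongr; exact hG (mem_image_of_mem _ hθ))
      gcongr
    · rw [indicator_of_notMem hT, mul_zero, norm_zero]
      positivity

theorem memLp_expScaled (hH : Assumptions H θs m) (hn : 0 < n)
    [IsFiniteMeasure (dirichlet α)] :
    MemLp (fun θ => expScaled n (H θ)) 2 (dirichlet α) := by
  obtain ⟨c, hc, hle⟩ := hH.exists_le_sub_gap
  refine MemLp.of_bound (C := Real.exp (n * realVersion H θs))
    (hH.aemeasurable_expScaled n _).aestronglyMeasurable ?_
  filter_upwards [ae_mem_simplex _] with θ hθ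
  rw [Real.norm_of_nonneg (expScaled_nonneg _ _)]
  refine expScaled_le hn ((hle θ hθ).trans (EReal.coe_le_coe_iff.2 ?_))
  nlinarith [gap_nonneg θs hθ]

end Moments

/-! ### Asymptotics of the normaliser and of the tilted integrals. -/

section Asymptotics

variable {H : (Fin (k + 1) → ℝ) → EReal} {α θs : Fin (k + 1) → ℝ} {m : ℕ} {ε γ : ℝ}

theorem Assumptions.last_pos (hH : Assumptions H θs m) : 0 < θs (Fin.last k) := by
  refine lt_of_le_of_ne (hH.mem_simplex.1 _) fun h => ?_
  have hm := (hH.zero_iff _).1 h.symm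
  have : ∑ i, θs i = 0 := Finset.sum_eq_zero fun i _ =>
    (hH.zero_iff i).2 (lt_of_le_of_lt (Fin.val_fin_le.2 (Fin.le_last i)) hm)
  rw [hH.mem_simplex.2] at this
  exact one_ne_zero this

theorem exists_ball_subset_truncSimplex (hεθ : ∀ i, 0 < θs i → ε < θs i) :
    ∃ δ > 0, ∀ θ ∈ simplex k, θ ∈ Metric.ball θs δ → θ ∈ truncSimplex θs ε := by
  have : ∀ᶠ θ in 𝓝 θs, ∀ i, 0 < θs i → ε ≤ θ i := by
    rw [eventually_all]
    intro i
    by_cases h : 0 < θs i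
    · filter_upwards [(continuous_apply i).continuousAt.eventually (lt_mem_nhds (hεθ i h))]
        with θ hθ _ using hθ.le
    · simp [h]
  obtain ⟨δ, hδ, h⟩ := Metric.eventually_nhds_iff_ball.1 this
  exact ⟨δ, hδ, fun θ hθ hb => ⟨hθ, h θ hb⟩⟩

theorem isTheta_integral_exp_klGap (hα : ∀ i, 0 < α i) [IsProbabilityMeasure (dirichlet α)]
    (hθs : θs ∈ simplex k) (hlast : 0 < θs (Fin.last k)) :
    (fun s => ∫ θ, Real.exp (-s * klGap θs θ) ∂dirichlet α) =Θ[atTop]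
      fun s : ℝ => s ^ (-decayRate α θs) := by
  obtain ⟨r, hr, hrθ⟩ := exists_pos_le_of_pos θs
  have hr2 : 0 < r / 2 := by positivity
  -- No truncation is present in this integral; an auxiliary level `r / 2` serves for the lower
  -- bound near `θs`.
  obtain ⟨δ, hδ, hball⟩ := exists_ball_subset_truncSimplex (k := k) (θs := θs) (ε := r / 2)
    fun i hi => by linarith [hrθ i hi]
  refine isTheta_integral_of_gap_bounds (F := fun s θ => Real.exp (-s * klGap θs θ))
    (c := 1 / 4) (C := max 1 (r / 2)⁻¹) hα hθs hlast (by norm_num) (by positivity) hδ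
    (Eventually.of_forall fun s => ?_) ?_ ?_
  · have := measurable_klGap θs
    exact Measurable.aestronglyMeasurable (by fun_prop)
  · filter_upwards [eventually_gt_atTop 0] with s hs θ hθ hpos
    refine ⟨(Real.exp_pos _).le, Real.exp_le_exp.2 ?_⟩
    have := gap_le_klGap hθs hθ hpos
    nlinarith
  · filter_upwards [eventually_gt_atTop 0] with s hs θ hθ hpos hb
    refine Real.exp_le_exp.2 ?_
    have := klGap_le_gap hθs hr2 (hball θ hθ hb)
    nlinarith

theorem isTheta_integral_expScaled (hH : Assumptions H θs m) (hα : ∀ i, 0 < α i)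
    [IsProbabilityMeasure (dirichlet α)] :
    (fun t => ∫ θ, expScaled t (H θ) * Real.exp (-t * realVersion H θs) ∂dirichlet α)
      =Θ[atTop] fun t : ℝ => t ^ (-decayRate α θs) := by
  obtain ⟨c, hc, hle⟩ := hH.exists_le_sub_gap
  obtain ⟨C, hC, δ, hδ, hge⟩ := hH.exists_sub_gap_le
  refine isTheta_integral_of_gap_bounds
    (F := fun t θ => expScaled t (H θ) * Real.exp (-t * realVersion H θs))
    hα hH.mem_simplex hH.last_pos hc hC hδ
    (Eventually.of_forall fun t =>
      ((hH.aemeasurable_expScaled t α).mul_const _).aestronglyMeasurable) ?_ ?_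
  · filter_upwards [eventually_gt_atTop 0] with t ht θ hθ hpos
    refine ⟨mul_nonneg (expScaled_nonneg _ _) (Real.exp_pos _).le, ?_⟩
    refine (mul_le_mul_of_nonneg_right (expScaled_le ht (hle θ hθ)) (Real.exp_pos _).le).trans ?_
    rw [← Real.exp_add]
    exact Real.exp_le_exp.2 (by linarith)
  · filter_upwards [eventually_gt_atTop 0] with t ht θ hθ hpos hb
    refine le_trans ?_ (mul_le_mul_of_nonneg_right (le_expScaled ht (hge θ hθ hb) (hH.ne_top θ))
      (Real.exp_pos _).le)
    rw [← Real.exp_add]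
    exact Real.exp_le_exp.2 (by linarith)

/-- The truncated Laplace integral with exponent `q * t`, tilted by a lower order term. -/
theorem isTheta_integral_tilted (hH : Assumptions H θs m) (hα : ∀ i, 0 < α i)
    (hε : 0 < ε) (hεθ : ∀ i, 0 < θs i → ε < θs i) {q : ℝ} (hq : 0 < q) {u : ℝ → ℝ}
    (hu0 : ∀ᶠ t in atTop, 0 ≤ u t) (hu : u =o[atTop] fun t : ℝ => t)
    [IsProbabilityMeasure (dirichlet α)] :
    (fun t => ∫ θ, expScaled (q * t) (H θ) * Real.exp (u t * klGap θs θ) *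
        (truncSimplex θs ε).indicator 1 θ * Real.exp (-(q * t) * realVersion H θs) ∂dirichlet α)
      =Θ[atTop] fun t : ℝ => t ^ (-decayRate α θs) := by
  obtain ⟨c, hc, hle⟩ := hH.exists_le_sub_gap
  obtain ⟨C, hC, δ, hδ, hge⟩ := hH.exists_sub_gap_le
  obtain ⟨δ', hδ', hball⟩ := exists_ball_subset_truncSimplex hεθ
  have hE : 0 < max 1 ε⁻¹ := by positivity
  -- Chosen so that the tilt costs at most half of the decay `q * c * t * gap` coming from `H`.
  have hub := hu.bound (c := q * c / 2 / max 1 ε⁻¹) (by positivity)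
  refine isTheta_integral_of_gap_bounds
    (F := fun t θ => expScaled (q * t) (H θ) * Real.exp (u t * klGap θs θ) *
        (truncSimplex θs ε).indicator 1 θ * Real.exp (-(q * t) * realVersion H θs))
    (c := q * c / 2) (C := q * C) (δ := min δ δ')
    hα hH.mem_simplex hH.last_pos (by positivity) (by positivity) (lt_min hδ hδ')
    (Eventually.of_forall fun t => ?_) ?_ ?_
  · have h1 := measurable_klGap θs
    have h2 : Measurable fun θ => Real.exp (u t * klGap θs θ) := by fun_prop
    exact ((((hH.aemeasurable_expScaled (q * t) α).mul h2.aemeasurable).mul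
      (measurable_one.indicator (isClosed_truncSimplex θs ε).measurableSet).aemeasurable).mul_const
        _).aestronglyMeasurable
  · filter_upwards [eventually_gt_atTop 0, hu0, hub] with t ht hut hub θ hθ hpos
    rw [Real.norm_of_nonneg hut, Real.norm_of_nonneg ht.le] at hub
    have hg0 := gap_nonneg θs hθ
    by_cases hT : θ ∈ truncSimplex θs ε
    · rw [indicator_of_mem hT, Pi.one_apply, mul_one]
      have h0 := expScaled_nonneg (q * t) (H θ)
      refine ⟨by positivity, ?_⟩
      have h1 := expScaled_le (mul_pos hq ht) (hle θ hθ)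
      have h2 : u t * klGap θs θ ≤ q * c / 2 * t * gap θs θ := by
        calc _ ≤ u t * (max 1 ε⁻¹ * gap θs θ) := by
              gcongr; exact klGap_le_gap hH.mem_simplex hε hT
          _ ≤ q * c / 2 / max 1 ε⁻¹ * t * (max 1 ε⁻¹ * gap θs θ) := by gcongr
          _ = _ := by field_simp
      calc _ ≤ Real.exp (q * t * (realVersion H θs - c * gap θs θ)) *
            Real.exp (q * c / 2 * t * gap θs θ) * Real.exp (-(q * t) * realVersion H θs) := by
            gcongr
        _ = _ := by rw [← Real.exp_add, ← Real.exp_add]; congr 1; ring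
    · rw [indicator_of_notMem hT, mul_zero, zero_mul]
      exact ⟨le_rfl, (Real.exp_pos _).le⟩
  · filter_upwards [eventually_gt_atTop 0, hu0] with t ht hut θ hθ hpos hb
    have hT := hball θ hθ (Metric.ball_subset_ball (min_le_right _ _) hb)
    have hb' := Metric.ball_subset_ball (min_le_left _ _) hb
    rw [indicator_of_mem hT, Pi.one_apply, mul_one]
    have h1 := le_expScaled (mul_pos hq ht) (hge θ hθ hb') (hH.ne_top θ)
    have h2 : 1 ≤ Real.exp (u t * klGap θs θ) := Real.one_le_exp <| mul_nonneg hut <| by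
      have := gap_le_klGap hH.mem_simplex hθ hpos
      have := gap_nonneg θs hθ
      linarith
    have h0 := expScaled_nonneg (q * t) (H θ)
    calc _ = Real.exp (q * t * (realVersion H θs - C * gap θs θ)) * 1 *
          Real.exp (-(q * t) * realVersion H θs) := by
          rw [mul_one, ← Real.exp_add]; congr 1; ring
      _ ≤ _ := by gcongr

theorem decayRate_pos (hk : 1 ≤ k) (hα : ∀ i, 0 < α i) : 0 < decayRate α θs := by
  have : Nonempty (Fin k) := ⟨⟨0, hk⟩⟩
  refine Finset.sum_pos (fun i _ => ?_) Finset.univ_nonempty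
  unfold coordRate
  split_ifs
  · exact hα _
  · norm_num

theorem sum_range_ite_half {m k : ℕ} (hmk : m ≤ k) :
    ∑ j ∈ Finset.range k, (if j < m then 0 else 1 / 2 : ℝ) = ((k : ℝ) - m) / 2 := by
  induction k, hmk using Nat.le_induction with
  | base => rw [Finset.sum_eq_zero fun j hj => if_pos (Finset.mem_range.1 hj)]; simp
  | succ k hk ih => rw [Finset.sum_range_succ, ih, if_neg hk.not_gt]; push_cast; ring

theorem Assumptions.decayRate_eq (hH : Assumptions H θs m) (α : Fin (k + 1) → ℝ) :
    decayRate α θs = ((k : ℝ) - m) / 2 +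
      ∑ i ∈ Finset.univ.filter (fun i : Fin (k + 1) => (i : ℕ) < m), α i := by
  have hmk : m ≤ k := by
    by_contra! h
    exact hH.last_pos.ne' ((hH.zero_iff _).2 (by simpa using h))
  rw [Finset.sum_filter, Fin.sum_univ_castSucc, Fin.val_last, if_neg hmk.not_gt, add_zero,
    ← sum_range_ite_half hmk,
    ← Fin.sum_univ_eq_sum_range (fun j => if j < m then 0 else 1 / 2 : ℕ → ℝ),
    ← Finset.sum_add_distrib, decayRate]
  refine Finset.sum_congr rfl fun i _ => ?_
  have : θs i.castSucc = 0 ↔ (i : ℕ) < m := hH.zero_iff _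
  by_cases h : (i : ℕ) < m <;> simp [coordRate, this, h]

theorem rpow_isLittleO_rpow {a b : ℝ} (h : a < b) :
    (fun t : ℝ => t ^ a) =o[atTop] fun t => t ^ b := by
  refine isLittleO_of_tendsto' ?_ ?_
  · filter_upwards [eventually_gt_atTop 0] with t ht h0
    exact absurd h0 (Real.rpow_pos_of_pos ht b).ne'
  · refine (tendsto_rpow_neg_atTop (sub_pos.2 h)).congr' ?_
    filter_upwards [eventually_gt_atTop 0] with t ht
    rw [← Real.rpow_sub ht, neg_sub]

end Asymptotics

theorem isTheta_congr' {X : Type*} {l : Filter X} {f₁ f₂ g₁ g₂ : X → ℝ} (h : f₁ =Θ[l] g₁)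
    (hf : f₁ =ᶠ[l] f₂) (hg : g₁ =ᶠ[l] g₂) : f₂ =Θ[l] g₂ :=
  ⟨h.1.congr' hf hg, h.2.congr' hg hf⟩

theorem isTheta_comp_tendsto {X Y : Type*} {l : Filter X} {l' : Filter Y} {f g : X → ℝ}
    (h : f =Θ[l] g) {u : Y → X} (hu : Tendsto u l' l) : (f ∘ u) =Θ[l'] (g ∘ u) :=
  ⟨h.1.comp_tendsto hu, h.2.comp_tendsto hu⟩

/-! ### Orders of the two variances and their quotient. -/

section Variances

variable {H : (Fin (k + 1) → ℝ) → EReal} {α θs : Fin (k + 1) → ℝ} {m : ℕ} {ε γ : ℝ}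

/-- The variance of `e^{n H}` under `Dir_α`, normalised by the squared maximum. -/
theorem isTheta_normalized_mc_variance (hk : 1 ≤ k) (hH : Assumptions H θs m)
    (hα : ∀ i, 0 < α i) [IsProbabilityMeasure (dirichlet α)] :
    (fun n => (∫ θ, expScaled n (H θ) ^ 2 ∂dirichlet α -
        (∫ θ, expScaled n (H θ) ∂dirichlet α) ^ 2) * Real.exp (-(2 * n) * realVersion H θs))
      =Θ[atTop] fun n : ℝ => n ^ (-decayRate α θs) := by
  set p := decayRate α θs
  set a : ℝ → ℝ := fun t =>
    ∫ θ, expScaled t (H θ) * Real.exp (-t * realVersion H θs) ∂dirichlet α with ha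
  have hp : 0 < p := decayRate_pos hk hα
  have h := isTheta_integral_expScaled hH hα
  have h2 : (fun n => a (2 * n)) =Θ[atTop] fun n : ℝ => n ^ (-p) := by
    refine (isTheta_comp_tendsto h (tendsto_id.const_mul_atTop (two_pos : (0 : ℝ) < 2))).trans ?_
    refine isTheta_congr' ((isTheta_const_mul_left (c := (2 : ℝ) ^ (-p)) (by positivity)).2
      (isTheta_refl (fun n : ℝ => n ^ (-p)) atTop)) ?_ EventuallyEq.rfl
    filter_upwards [eventually_gt_atTop 0] with n hn
    rw [Function.comp, id, Real.mul_rpow two_pos.le hn.le]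
  -- The squared mean has order `n ^ (-2p)`, negligible against the second moment because `p > 0`.
  have h1 : (fun n => a n ^ 2) =o[atTop] fun n : ℝ => n ^ (-p) := by
    refine (h.pow 2).isBigO.trans_isLittleO ?_
    refine (rpow_isLittleO_rpow (by linarith : -p * 2 < -p)).congr' ?_ EventuallyEq.rfl
    filter_upwards [eventually_gt_atTop 0] with n hn
    rw [Real.rpow_mul hn.le, Real.rpow_two]
  refine isTheta_congr' (h2.add_isLittleO h1.neg_left) ?_ EventuallyEq.rfl
  filter_upwards [eventually_gt_atTop 0] with n hn
  have hexp : Real.exp (-n * realVersion H θs) ^ 2 = Real.exp (-(2 * n) * realVersion H θs) := by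
    rw [← Real.exp_nat_mul]
    push_cast
    ring_nf
  simp only [ha, integral_mul_const, Pi.add_apply]
  rw [integral_congr_ae (ae_of_all _ fun θ => expScaled_sq hn (hH.ne_top θ)), mul_pow, hexp]
  ring

/-- The variance of the importance sampling summand, normalised by the squared maximum. -/
theorem isTheta_normalized_is_variance (hk : 1 ≤ k) (hH : Assumptions H θs m)
    (hα : ∀ i, 0 < α i) (hγ : γ ∈ Ioo (0 : ℝ) 1) (hε : 0 < ε) (hεθ : ∀ i, 0 < θs i → ε < θs i)
    [IsProbabilityMeasure (dirichlet α)]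
    (hprob : ∀ n : ℝ, 0 < n → IsProbabilityMeasure (dirichlet (α + n ^ γ • θs))) :
    (fun n => (∫ θ, isWeight H α θs ε n (n ^ γ) θ ^ 2 ∂dirichlet (α + n ^ γ • θs) -
        (∫ θ, isWeight H α θs ε n (n ^ γ) θ ∂dirichlet (α + n ^ γ • θs)) ^ 2) *
          Real.exp (-(2 * n) * realVersion H θs))
      =Θ[atTop] fun n : ℝ => n ^ (-γ * decayRate α θs) * n ^ (-decayRate α θs) := by
  set p := decayRate α θs
  have hp : 0 < p := decayRate_pos hk hα
  have hZ : (fun n : ℝ => ∫ θ, Real.exp (-n ^ γ * klGap θs θ) ∂dirichlet α) =Θ[atTop]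
      fun n : ℝ => n ^ (-γ * p) := by
    refine isTheta_congr' (isTheta_comp_tendsto
      (isTheta_integral_exp_klGap hα hH.mem_simplex hH.last_pos)
      (tendsto_rpow_atTop hγ.1)) EventuallyEq.rfl ?_
    filter_upwards [eventually_gt_atTop 0] with n hn
    rw [Function.comp, ← Real.rpow_mul hn.le]
    congr 1
    ring
  have hD := isTheta_integral_tilted (u := fun n => n ^ γ) hH hα hε hεθ two_pos
    (by filter_upwards [eventually_gt_atTop 0] with n hn using Real.rpow_nonneg hn.le _)
    (by simpa using rpow_isLittleO_rpow hγ.2)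
  -- The mean is the untilted case, with exponent `n` in place of `2 * n`.
  have hA := isTheta_integral_tilted (u := fun _ => 0) hH hα hε hεθ one_pos
    (Eventually.of_forall fun _ => le_rfl) (isLittleO_zero _ _)
  have hA2 := (hA.pow 2).isBigO.trans_isLittleO
    (g := fun n : ℝ => (n ^ (-p)) ^ 2) (k := fun n : ℝ => n ^ (-γ * p) * n ^ (-p)) (by
      -- The squared mean is of lower order exactly because `γ < 1`: `-2p < -γp - p`.
      refine (rpow_isLittleO_rpow (by nlinarith [hγ.2] : -p * 2 < -γ * p + -p)).congr' ?_ ?_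
      · filter_upwards [eventually_gt_atTop 0] with n hn
        rw [Real.rpow_mul hn.le, Real.rpow_two]
      · filter_upwards [eventually_gt_atTop 0] with n hn
        rw [Real.rpow_add hn])
  refine isTheta_congr' ((hZ.mul hD).add_isLittleO hA2.neg_left) ?_ EventuallyEq.rfl
  filter_upwards [eventually_gt_atTop 0] with n hn
  have := hprob n hn
  have hs := Real.rpow_nonneg hn.le γ
  rw [integral_isWeight_sq hα hH.mem_simplex.1 hs hn hH.ne_top,
    integral_isWeight hα hH.mem_simplex.1 hs]
  have hexp : Real.exp (-n * realVersion H θs) ^ 2 = Real.exp (-(2 * n) * realVersion H θs) := by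
    rw [← Real.exp_nat_mul]
    push_cast
    ring_nf
  simp only [integral_mul_const, one_mul, zero_mul, Real.exp_zero, mul_one, Pi.add_apply]
  rw [mul_pow, hexp]
  ring

end Variances

end DirichletIS

theorem theorem4 {k : ℕ} (hk : 1 ≤ k)
    (α : Fin (k + 1) → ℝ) (hα : ∀ i, 0 < α i)
    (H : (Fin (k + 1) → ℝ) → EReal) (θs : Fin (k + 1) → ℝ) (m : ℕ)
    (hH : DirichletIS.Assumptions H θs m)
    (γ : ℝ) (hγ : γ ∈ Set.Ioo (0 : ℝ) 1)
    (ε : ℝ) (hε : 0 < ε) (hεθ : ∀ i, 0 < θs i → ε < θs i)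
    (N : ℕ) (hN : 1 ≤ N)
    {Ω : Type*} [MeasurableSpace Ω] (P : Measure Ω) [IsProbabilityMeasure P]
    (X : Fin N → Ω → Fin (k + 1) → ℝ)
    (hX : DirichletIS.IsIIDSample X (DirichletIS.dirichlet α) P)
    {Ω' : ℝ → Type*} [∀ n, MeasurableSpace (Ω' n)] (P' : ∀ n, Measure (Ω' n))
    [∀ n, IsProbabilityMeasure (P' n)]
    (Y : ∀ n, Fin N → Ω' n → Fin (k + 1) → ℝ)
    (hY : ∀ n, 0 < n → DirichletIS.IsIIDSample (Y n)
      (DirichletIS.dirichlet (DirichletIS.proposalParam α θs γ n)) (P' n)) :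
    (fun n : ℝ => variance (DirichletIS.isEstimator H α θs γ ε n (Y n)) (P' n) /
        variance (DirichletIS.mcEstimator H n X) P)
      =Θ[atTop]
    (fun n : ℝ => n ^ (-γ * (((k : ℝ) - m) / 2)) *
      n ^ (-γ * ∑ i ∈ Finset.univ.filter (fun i : Fin (k + 1) => (i : ℕ) < m), α i)) := by
  have := hX.isProbabilityMeasure hN
  have hpar : ∀ n : ℝ, DirichletIS.proposalParam α θs γ n = α + n ^ γ • θs := fun n => rfl
  have hprob : ∀ n : ℝ, 0 < n →
      IsProbabilityMeasure (DirichletIS.dirichlet (α + n ^ γ • θs)) := fun n hn =>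
    (hY n hn).isProbabilityMeasure hN
  have hmain := (DirichletIS.isTheta_normalized_is_variance hk hH hα hγ hε hεθ hprob).div
    (DirichletIS.isTheta_normalized_mc_variance hk hH hα)
  refine DirichletIS.isTheta_congr' hmain ?_ ?_
  · filter_upwards [eventually_gt_atTop 0] with n hn
    have := hprob n hn
    have hmc := hX.variance_mean hN (DirichletIS.memLp_expScaled (α := α) hH hn)
    have his := (hY n hn).variance_mean hN
      (DirichletIS.memLp_isWeight (ε := ε) hH hα (Real.rpow_nonneg hn.le γ) hn hε)
    have hN0 : (1 / (N : ℝ)) ≠ 0 := one_div_ne_zero (by positivity)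
    unfold DirichletIS.isEstimator DirichletIS.mcEstimator
    refine Eq.trans ?_ (congrArg₂ (· / ·) his hmc).symm
    rw [hpar]
    -- The normalising exponential and the factor `1 / N` are common to both variances and cancel.
    exact (mul_div_mul_right _ _ (Real.exp_pos _).ne').trans (mul_div_mul_left _ _ hN0).symm
  · filter_upwards [eventually_gt_atTop 0] with n hn
    rw [mul_div_cancel_right₀ _ (Real.rpow_pos_of_pos hn _).ne', ← Real.rpow_add hn,
      hH.decayRate_eq, mul_add]
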